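/- Let $E=\{0,1,2,\dots\}$, and let $Q=(q_{ij})_{i,j\ge 0}$ be a real matrix with $q_{ij}\ge 0$ for $i\ne j$, $q_i:=-q_{ii}\ge\sum_{j\neq i}q_{ij}$ for all $i$, $q_{0j}=0$ for all $j\ge 0$, and, for $i\ge 1$, $q_{i,i-1}>0$ and $q_{ij}=0$ for $0\le j<i-1$. Let $c_i=-\sum_{j\ge i-1}q_{ij}\ge 0$ $(i\ge 1)$ be the killing rates, and assume $c_{i_0}>0$ for some $i_0\ge 1$. Let $X=(X_t)_{t\ge0}$ be a single death process with killing corresponding to $Q$: under $\mathbb P_i$ $(i\in E)$, $X$ is a time-homogeneous Markov process on $E\cup\{\partial\}$ started at $i$, with right-continuous paths for the discrete topology, absorbed at the cemetery $\partial$, whose transition function $p_{ij}(t)=\mathbb P_i[X_t=j]$ $(i,j\in E)$ satisfies $p_{ij}'(0+)=q_{ij}$. Put $T_a=\inf\{t\ge0:X_t=a\}$, $T_{N+}=\inf\{t\ge0:X_t\in E,\ X_t\ge N\}$ and $T_\partial=\inf\{t\ge0:X_t=\partial\}$, with $\inf\emptyset=\infty$. For a function $f=(f_i)_{i\ge1}$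 with values in $[0,\infty)$ set $q_n^{(k)}(f)=\sum_{j\ge k}q_{nj}+f_n$, and $$G_n^{(n)}(f)=1\ (n\ge1),\qquad G_n^{(k)}(f)=\sum_{l=n+1}^{k}\frac{q_n^{(l)}(f)\,G_l^{(k)}(f)}{q_{n,n-1}}\ (k>n\ge1),\qquad W^{(f)}(i,j)=\sum_{k=i+1}^{j}\frac{G_k^{(j)}(f)}{q_{j,j-1}}\ (i,j\ge0),$$ where empty sums are $0$. Let $\omega=(\omega_i)_{i\ge1}$ be a non-negative function on $\{1,2,\dots\}$, and write $W=W^{(\omega+c)}$. Then: (1) for all integers $0\le a<i<N$, $$\mathbb E_i\Big[\exp\Big(-\int_0^{T_a}\omega(X_t)\,dt\Big);\,T_a<T_{N+}\wedge T_\partial\Big]=\frac{W(i,N)}{W(a,N)};$$ (2) for all integers $a\ge 0$ and $i,j,N$ with $a<i<N$ and $a<j<N$, $$\mathbb E_i\Big[\int_0^{T_a\wedge T_{N+}\wedge T_\partial}\exp\Big(-\int_0^t\omega(X_s)\,ds\Big)\mathbf 1_{\{X_t=j\}}\,dt\Big]=\frac{W(a,j)\,W(i,N)}{W(a,N)}-W(i,j);$$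 (3) for all integers $0\le a<i<N$, $$\mathbb E_i\Big[\exp\Big(-\int_0^{T_{N+}\wedge T_\partial}\omega(X_t)\,dt\Big);\,T_{N+}\wedge T_\partial<T_a\Big]=1+\sum_{i<j<N}\omega_jW(i,j)-\frac{W(i,N)}{W(a,N)}\Big(1+\sum_{a<j<N}\omega_jW(a,j)\Big).$$ -/

import Mathlib

open MeasureTheory Filter Topology
open scoped NNReal ENNReal

noncomputable section

namespace SingleDeath

/-- A totally stable transition rate matrix on `{0, 1, 2, …}` of single death type: off-diagonal
entries are non-negative, rows are summable with sum at most `0` (that is,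
`q_i = -q_{ii} ≥ ∑_{j ≠ i} q_{ij}`, with `q_i` finite), `0` is absorbing, and from `i ≥ 1` the only
downward jump is to `i - 1`, at a positive rate. -/
structure IsRateMatrix (Q : ℕ → ℕ → ℝ) : Prop where
  nonneg : ∀ i j, i ≠ j → 0 ≤ Q i j
  summable : ∀ i, Summable (Q i)
  row_sum_le : ∀ i, ∑' j, Q i j ≤ 0
  zero_row : ∀ j, Q 0 j = 0
  down_pos : ∀ i, 1 ≤ i → 0 < Q i (i - 1)
  skip_free : ∀ i j, j + 1 < i → Q i j = 0

/-- The killing rate `c_i = -∑_j q_{ij}`; for a single death matrix and `i ≥ 1` the terms with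
`j < i - 1` vanish. -/
def killingRate (Q : ℕ → ℕ → ℝ) (i : ℕ) : ℝ := -∑' j, Q i j

/-- `q_n^{(k)}(ω) = ∑_{j ≥ k} q_{nj} + ω_n`. -/
def qTail (Q : ℕ → ℕ → ℝ) (ω : ℕ → ℝ) (n k : ℕ) : ℝ := ∑' j, Q n (k + j) + ω n

/-- `G Q ω k n` is `G_n^{(k)}(ω)`, for `1 ≤ n ≤ k`: it is `1` for `n = k` and
`∑_{l = n+1}^{k} q_n^{(l)}(ω) G_l^{(k)}(ω) / q_{n,n-1}` for `n < k`. -/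
def G (Q : ℕ → ℕ → ℝ) (ω : ℕ → ℝ) (k n : ℕ) : ℝ :=
  if n = k then 1
  else ∑ l : Finset.Icc (n + 1) k, qTail Q ω n l * G Q ω k l / Q n (n - 1)
termination_by k - n
decreasing_by
  have := Finset.mem_Icc.mp l.2
  omega

/-- The scale-type function `W^{(ω)}(i,j) = ∑_{k = i+1}^{j} G_k^{(j)}(ω) / q_{j,j-1}`. -/
def W (Q : ℕ → ℕ → ℝ) (ω : ℕ → ℝ) (i j : ℕ) : ℝ :=
  ∑ k ∈ Finset.Icc (i + 1) j, G Q ω j k / Q j (j - 1)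

variable {Ω : Type*}

/-- The state space of the killed process is `E ∪ {∂}`, modelled by `Option ℕ` with `∂ = none`.
This is the transition function `p_{ij}(t) = ℙ_i[X_t = j]`, for `i, j ∈ E`. -/
def transProb [MeasurableSpace Ω] (X : ℝ≥0 → Ω → Option ℕ) (P : ℕ → Measure Ω)
    (t : ℝ≥0) (i j : ℕ) : ℝ :=
  (P i).real {w | X t w = some j}

/-- `X`, under the laws `P i` (`i ∈ E`), is a continuous-time Markov chain on `E ∪ {∂}` started
from `i`, with cemetery `∂` and with transition rate matrix `Q` on `E`: its paths are
right-continuous for the discrete topology, it is absorbed at `∂`, it is time-homogeneous Markov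
with transition function `p_{ij}(t)`, and `p_{ij}'(0+) = q_{ij}`. -/
structure IsKilledChain [MeasurableSpace Ω] (Q : ℕ → ℕ → ℝ) (X : ℝ≥0 → Ω → Option ℕ)
    (P : ℕ → Measure Ω) : Prop where
  prob : ∀ i, IsProbabilityMeasure (P i)
  measurable : ∀ t x, MeasurableSet {w | X t w = x}
  right_cont : ∀ w t, ∀ᶠ s in 𝓝[≥] t, X s w = X t w
  absorbed : ∀ w s t, s ≤ t → X s w = none → X t w = none
  markov : ∀ (n : ℕ) (t : ℕ → ℝ≥0) (x : ℕ → ℕ), Monotone t → t 0 = 0 →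
    (P (x 0)).real {w | ∀ k ≤ n, X (t k) w = some (x k)} =
      ∏ k ∈ Finset.range n, transProb X P (t (k + 1) - t k) (x k) (x (k + 1))
  rates : ∀ i j, Tendsto (fun t : ℝ≥0 => (transProb X P t i j - if i = j then 1 else 0) / (t : ℝ))
    (𝓝[>] 0) (𝓝 (Q i j))

/-- First entrance time `inf {t ≥ 0 : X_t ∈ S}`, with `inf ∅ = ∞`. -/
def entryTime (X : ℝ≥0 → Ω → Option ℕ) (S : Set (Option ℕ)) (w : Ω) : ℝ≥0∞ :=
  ⨅ (t : ℝ≥0) (_ : X t w ∈ S), (t : ℝ≥0∞)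

/-- `T_a = inf {t ≥ 0 : X_t = a}`. -/
def hitTime (X : ℝ≥0 → Ω → Option ℕ) (a : ℕ) : Ω → ℝ≥0∞ := entryTime X {some a}

/-- `T_{N+} = inf {t ≥ 0 : X_t ≥ N}`. -/
def passTime (X : ℝ≥0 → Ω → Option ℕ) (N : ℕ) : Ω → ℝ≥0∞ := entryTime X (some '' Set.Ici N)

/-- `T_∂ = inf {t ≥ 0 : X_t ∉ E}`. -/
def killTime (X : ℝ≥0 → Ω → Option ℕ) : Ω → ℝ≥0∞ := entryTime X {none}

/-- The Lebesgue integral `∫_0^T f(t) dt`, for `f ≥ 0` and `T ∈ [0, ∞]`. -/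
def timeIntegral (T : ℝ≥0∞) (f : ℝ≥0 → ℝ≥0∞) : ℝ≥0∞ :=
  ∫⁻ t in {t : ℝ | 0 ≤ t ∧ ENNReal.ofReal t < T}, f t.toNNReal

/-- The discount factor `exp (-∫_0^T ω(X_s) ds) ∈ [0, 1]`, for `T ∈ [0, ∞]`, where `ω ≥ 0` is
extended by `ω(∂) = 0` and `exp (-∞) = 0`. -/
def discount (ω : ℕ → ℝ) (X : ℝ≥0 → Ω → Option ℕ) (T : ℝ≥0∞) (w : Ω) : ℝ≥0∞ :=
  EReal.exp (-(timeIntegral T fun s => ENNReal.ofReal ((X s w).elim 0 ω) : EReal))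

end SingleDeath

end

open SingleDeath

/-!
For a function `v` on `E ∪ {∂}` that is constant on `[N, ∞) ∪ {∂}`, only finitely many of the limits
`p_{ij}'(0+) = q_{ij}` enter `(Q - ω) v`. Dynkin's formula for such `v`, up to the exit time from a
finite set, therefore follows from the finite-dimensional distributions alone: along the skeleton of
mesh `h` the discounted increments of `v` telescope, the Markov property turns their means into
those of a Riemann sum, and right-continuity of the paths lets `h → 0`.

The three quantities are then the solutions of Dirichlet and Poisson problems for `Q - ω` on the
interval `(a, N)`, and these are solved by `W` because `(Q - ω) W(·, j) = δ_j` on `[1, N)` for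
`j ≤ N`: summing the row of `Q` by parts yields the tails `q_k^{(l)}(ω + c)`, and the recursion
defining `G` cancels them. With `ω = 0` the same columns produce a bounded function with
`Q v = -1` on `(a, N)`, so that the exit time is almost surely finite, and by skip-freeness the
chain leaves `(a, N)` through `a`, through `[N, ∞)` or through `∂`.
-/

noncomputable section

namespace SingleDeath

section Paths

/-! ### Right-continuous step paths and Riemann sums -/

variable {α : Type*}

/-- A path that is right-continuous for the discrete topology. -/
def RightConst (x : ℝ≥0 → α) : Prop := ∀ t, ∀ᶠ s in 𝓝[≥] t, x s = x t

lemma RightConst.comp {β : Type*} {x : ℝ≥0 → α} (hx : RightConst x) (f : α → β) :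
    RightConst fun t => f (x t) := fun t => (hx t).mono fun _ hs => congrArg f hs

lemma le_ceil_div_mul (t : ℝ≥0) {h : ℝ≥0} (hh : 0 < h) : t ≤ ⌈t / h⌉₊ * h := by
  calc t = t / h * h := (div_mul_cancel₀ t hh.ne').symm
    _ ≤ _ := by gcongr; exact Nat.le_ceil _

lemma ceil_div_mul_le (t : ℝ≥0) {h : ℝ≥0} (hh : 0 < h) : ⌈t / h⌉₊ * h ≤ t + h := by
  calc ⌈t / h⌉₊ * h ≤ (t / h + 1) * h := by
        gcongr; exact (Nat.ceil_lt_add_one zero_le).le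
    _ = t + h := by rw [add_mul, div_mul_cancel₀ t hh.ne', one_mul]

lemma natCast_mul_lt_of_lt_ceil {t h : ℝ≥0} {k : ℕ} (hk : k < ⌈t / h⌉₊) : k * h < t := by
  rcases eq_zero_or_pos h with rfl | hh
  · simp at hk
  · exact (lt_div_iff₀ hh).1 (Nat.lt_ceil.1 hk)

lemma tendsto_ceil_div_mul (t : ℝ≥0) :
    Tendsto (fun h : ℝ≥0 => ⌈t / h⌉₊ * h) (𝓝[>] 0) (𝓝[≥] t) := by
  have hpos : ∀ᶠ h : ℝ≥0 in 𝓝[>] 0, 0 < h := self_mem_nhdsWithin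
  refine tendsto_nhdsWithin_iff.2 ⟨?_, hpos.mono fun h => le_ceil_div_mul t⟩
  have hup : Continuous fun h : ℝ≥0 => t + h := by fun_prop
  exact tendsto_of_tendsto_of_tendsto_of_le_of_le' tendsto_const_nhds
    (by simpa using tendsto_nhdsWithin_of_tendsto_nhds (hup.tendsto 0))
    (hpos.mono fun h => le_ceil_div_mul t) (hpos.mono fun h => ceil_div_mul_le t)

lemma RightConst.eventually_ceil_eq {x : ℝ≥0 → α} (hx : RightConst x) (t : ℝ≥0) :
    ∀ᶠ h : ℝ≥0 in 𝓝[>] 0, x (⌈t / h⌉₊ * h) = x t :=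
  (tendsto_ceil_div_mul t).eventually (hx t)

lemma RightConst.measurable {x : ℝ≥0 → ℝ} (hx : RightConst x) : Measurable x := by
  refine measurable_of_tendsto_metrizable' (𝓝[>] (0 : ℝ≥0))
    (f := fun h t => x (⌈t / h⌉₊ * h)) (fun h => ?_) (tendsto_pi_nhds.2 fun t => ?_)
  · exact (measurable_of_countable fun n : ℕ => x (n * h)).comp
      (Nat.measurable_ceil.comp (measurable_id.div_const h))
  · exact tendsto_const_nhds.congr' ((hx.eventually_ceil_eq t).mono fun h hh => hh.symm)

lemma intervalIntegrable_ceil (f : ℕ → ℝ) (h : ℝ≥0) {C : ℝ} (hC : ∀ k, |f k| ≤ C) (a b : ℝ) :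
    IntervalIntegrable (fun s : ℝ => f ⌈s.toNNReal / h⌉₊) volume a b := by
  refine intervalIntegrable_const (c := C) |>.mono_fun ?_ ?_
  · exact ((measurable_of_countable f).comp (Nat.measurable_ceil.comp
      (measurable_real_toNNReal.div_const h))).aestronglyMeasurable
  · exact ae_of_all _ fun s => (hC _).trans (le_abs_self C)

lemma intervalIntegral_ceil (f : ℕ → ℝ) {h : ℝ≥0} (hh : 0 < h) {C : ℝ} (hC : ∀ k, |f k| ≤ C)
    (n : ℕ) :
    ∫ s in (0 : ℝ)..(n * h : ℝ≥0), f ⌈s.toNNReal / h⌉₊ =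
      h * ∑ k ∈ Finset.range n, f (k + 1) := by
  induction n with
  | zero => simp
  | succ n ih =>
    have hlast : ∫ s in ((n * h : ℝ≥0) : ℝ)..((n + 1 : ℕ) * h : ℝ≥0), f ⌈s.toNNReal / h⌉₊ =
        h * f (n + 1) := by
      have hconst : ∀ s ∈ Set.Ioc ((n * h : ℝ≥0) : ℝ) ((n + 1 : ℕ) * h : ℝ≥0),
          f ⌈s.toNNReal / h⌉₊ = f (n + 1) := fun s hs => by
        congr 1
        rw [Nat.ceil_eq_iff (by omega), lt_div_iff₀ hh, div_le_iff₀ hh]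
        exact ⟨Real.lt_toNNReal_iff_coe_lt.2 hs.1, Real.toNNReal_le_iff_le_coe.2 hs.2⟩
      have hle : ((n * h : ℝ≥0) : ℝ) ≤ ((n + 1 : ℕ) * h : ℝ≥0) := by
        norm_cast; gcongr; omega
      rw [intervalIntegral.integral_of_le hle,
        setIntegral_congr_fun measurableSet_Ioc hconst, ← intervalIntegral.integral_of_le hle,
        intervalIntegral.integral_const, smul_eq_mul]
      push_cast
      ring
    rw [← intervalIntegral.integral_add_adjacent_intervals (intervalIntegrable_ceil f h hC _ _)
      (intervalIntegrable_ceil f h hC _ _), ih, hlast, Finset.sum_range_succ, mul_add]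

lemma abs_riemannSum_sub_intervalIntegral_le (f : ℕ → ℝ) {h : ℝ≥0} (hh : 0 < h) {C : ℝ}
    (hC : ∀ k, |f k| ≤ C) (t : ℝ≥0) :
    |h * ∑ k ∈ Finset.range ⌈t / h⌉₊, f k - ∫ s in (0 : ℝ)..t, f ⌈s.toNNReal / h⌉₊| ≤
      3 * C * h := by
  set n := ⌈t / h⌉₊
  have hshift : ∑ k ∈ Finset.range n, f k = ∑ k ∈ Finset.range n, f (k + 1) + f 0 - f n := by
    rw [← Finset.sum_range_succ', Finset.sum_range_succ, add_sub_cancel_right]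
  have htail : |∫ s in (t : ℝ)..(n * h : ℝ≥0), f ⌈s.toNNReal / h⌉₊| ≤ C * h := by
    have hle : ((n * h : ℝ≥0) : ℝ) ≤ t + h := by exact_mod_cast ceil_div_mul_le t hh
    have hge : (t : ℝ) ≤ (n * h : ℝ≥0) := by exact_mod_cast le_ceil_div_mul t hh
    have hC0 : 0 ≤ C := (abs_nonneg _).trans (hC 0)
    calc |∫ s in (t : ℝ)..(n * h : ℝ≥0), f ⌈s.toNNReal / h⌉₊|
        ≤ C * |((n * h : ℝ≥0) : ℝ) - t| :=
          intervalIntegral.norm_integral_le_of_norm_le_const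
            (f := fun s : ℝ => f ⌈s.toNNReal / h⌉₊) fun s _ => hC _
      _ ≤ C * h := by rw [abs_of_nonneg (by linarith)]; gcongr; linarith
  have hsplit := intervalIntegral.integral_add_adjacent_intervals
    (intervalIntegrable_ceil f h hC 0 t) (intervalIntegrable_ceil f h hC t (n * h : ℝ≥0))
  rw [intervalIntegral_ceil f hh hC] at hsplit
  have hdiff : h * ∑ k ∈ Finset.range n, f k - ∫ s in (0 : ℝ)..t, f ⌈s.toNNReal / h⌉₊ =
      h * f 0 - h * f n + ∫ s in (t : ℝ)..(n * h : ℝ≥0), f ⌈s.toNNReal / h⌉₊ := by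
    rw [hshift]; linarith
  have hterm : ∀ k, |(h : ℝ) * f k| ≤ C * h := fun k => by
    rw [abs_mul, abs_of_nonneg h.coe_nonneg, mul_comm]
    exact mul_le_mul_of_nonneg_right (hC k) h.coe_nonneg
  rw [hdiff]
  linarith [abs_add_le (h * f 0 - h * f n) (∫ s in (t : ℝ)..(n * h : ℝ≥0), f ⌈s.toNNReal / h⌉₊),
    abs_sub (h * f 0) (h * f n), hterm 0, hterm n]

lemma tendsto_riemannSum {f : ℝ≥0 → ℕ → ℝ} {φ : ℝ≥0 → ℝ} {C : ℝ}
    (hC : ∀ᶠ h in 𝓝[>] 0, ∀ k, |f h k| ≤ C)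
    (hf : ∀ s, Tendsto (fun h => f h ⌈s / h⌉₊) (𝓝[>] 0) (𝓝 (φ s))) (t : ℝ≥0) :
    Tendsto (fun h : ℝ≥0 => h * ∑ k ∈ Finset.range ⌈t / h⌉₊, f h k) (𝓝[>] 0)
      (𝓝 (∫ s in (0 : ℝ)..t, φ s.toNNReal)) := by
  have hpos : ∀ᶠ h : ℝ≥0 in 𝓝[>] 0, 0 < h := self_mem_nhdsWithin
  have hint : Tendsto (fun h : ℝ≥0 => ∫ s in (0 : ℝ)..t, f h ⌈s.toNNReal / h⌉₊) (𝓝[>] 0)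
      (𝓝 (∫ s in (0 : ℝ)..t, φ s.toNNReal)) := by
    refine intervalIntegral.tendsto_integral_filter_of_dominated_convergence (fun _ => C)
      ?_ ?_ (by simp) (ae_of_all _ fun s _ => hf s.toNNReal)
    · exact hC.mono fun h hCh => (intervalIntegrable_ceil (f h) h hCh 0 t).def'.1
    · exact hC.mono fun h hCh => ae_of_all _ fun s _ => hCh _
  have herr : Tendsto (fun h : ℝ≥0 => h * ∑ k ∈ Finset.range ⌈t / h⌉₊, f h k -
      ∫ s in (0 : ℝ)..t, f h ⌈s.toNNReal / h⌉₊) (𝓝[>] 0) (𝓝 0) := by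
    refine squeeze_zero_norm' (a := fun h : ℝ≥0 => 3 * C * h) ?_ ?_
    · filter_upwards [hC, hpos] with h hCh hh
      exact abs_riemannSum_sub_intervalIntegral_le (f h) hh hCh t
    · have hlin : Continuous fun h : ℝ≥0 => 3 * C * h := by fun_prop
      simpa using tendsto_nhdsWithin_of_tendsto_nhds (hlin.tendsto 0)
  simpa using herr.add hint

lemma RightConst.tendsto_riemannSum {x : ℝ≥0 → ℝ} (hx : RightConst x) {C : ℝ}
    (hC : ∀ s, |x s| ≤ C) (t : ℝ≥0) :
    Tendsto (fun h : ℝ≥0 => h * ∑ k ∈ Finset.range ⌈t / h⌉₊, x (k * h)) (𝓝[>] 0)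
      (𝓝 (∫ s in (0 : ℝ)..t, x s.toNNReal)) :=
  SingleDeath.tendsto_riemannSum (f := fun h k => x (k * h))
    (Eventually.of_forall fun _ _ => hC _)
    (fun s => tendsto_const_nhds.congr' ((hx.eventually_ceil_eq s).mono fun _ hh => hh.symm)) t

end Paths

section StoppedPaths

variable {α : Type*}

lemma abs_indicator_le (A : Set α) {f : α → ℝ} {C : ℝ} (hC : ∀ o, |f o| ≤ C) (o : α) :
    |A.indicator f o| ≤ C :=
  (norm_indicator_le_norm_self f o).trans (hC o)

/-- The discount factor at step `n` of a sequence `y`, at rate `r` and with mesh `h`, set to `0`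
once `y` has visited the complement of `A`. -/
def skeletonDiscount (A : Set α) (r : α → ℝ) (h : ℝ≥0) (y : ℕ → α) (n : ℕ) : ℝ :=
  ∏ k ∈ Finset.range n, A.indicator (fun o => Real.exp (-(h * r o))) (y k)

lemma skeletonDiscount_nonneg (A : Set α) (r : α → ℝ) (h : ℝ≥0) (y : ℕ → α) (n : ℕ) :
    0 ≤ skeletonDiscount A r h y n :=
  Finset.prod_nonneg fun _ _ => Set.indicator_nonneg (fun _ _ => (Real.exp_pos _).le) _

lemma skeletonDiscount_le_one (A : Set α) {r : α → ℝ} (hr : ∀ o, 0 ≤ r o) (h : ℝ≥0) (y : ℕ → α)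
    (n : ℕ) : skeletonDiscount A r h y n ≤ 1 := by
  refine Finset.prod_le_one (fun _ _ => Set.indicator_nonneg (fun _ _ => (Real.exp_pos _).le) _)
    fun k _ => Set.indicator_le_self' (fun _ _ => (Real.exp_pos _).le) _ |>.trans ?_
  exact Real.exp_le_one_iff.2 (neg_nonpos.2 (mul_nonneg h.coe_nonneg (hr _)))

lemma skeletonDiscount_eq_exp {A : Set α} {r : α → ℝ} {h : ℝ≥0} {y : ℕ → α} {n : ℕ}
    (hy : ∀ k < n, y k ∈ A) :
    skeletonDiscount A r h y n = Real.exp (-(h * ∑ k ∈ Finset.range n, r (y k))) := by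
  rw [skeletonDiscount, Finset.mul_sum, ← Finset.sum_neg_distrib, Real.exp_sum]
  exact Finset.prod_congr rfl fun k hk => Set.indicator_of_mem (hy k (Finset.mem_range.1 hk)) _

lemma skeletonDiscount_mul_indicator_eq_zero {A : Set α} {r f : α → ℝ} {h : ℝ≥0} {y : ℕ → α}
    {m n : ℕ} (hmn : m ≤ n) (hy : y m ∉ A) :
    skeletonDiscount A r h y n * A.indicator f (y n) = 0 := by
  rcases hmn.eq_or_lt with rfl | hlt
  · rw [Set.indicator_of_notMem hy, mul_zero]
  · rw [skeletonDiscount, Finset.prod_eq_zero (Finset.mem_range.2 hlt)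
      (Set.indicator_of_notMem hy _), zero_mul]

lemma skeletonDiscount_succ (A : Set α) (r : α → ℝ) (h : ℝ≥0) (y : ℕ → α) (n : ℕ) :
    skeletonDiscount A r h y (n + 1) =
      skeletonDiscount A r h y n * A.indicator (fun o => Real.exp (-(h * r o))) (y n) :=
  Finset.prod_range_succ _ _

lemma abs_skeletonDiscount_mul_le (A : Set α) {r : α → ℝ} (hr : ∀ o, 0 ≤ r o) (h : ℝ≥0)
    (y : ℕ → α) (n : ℕ) {u C : ℝ} (hu : |u| ≤ C) : |skeletonDiscount A r h y n * u| ≤ C := by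
  rw [abs_mul, abs_of_nonneg (skeletonDiscount_nonneg ..)]
  exact (mul_le_of_le_one_left (abs_nonneg _) (skeletonDiscount_le_one A hr h y n)).trans hu

lemma dependsOn_skeletonDiscount (A : Set α) (r : α → ℝ) (h : ℝ≥0) (n : ℕ) :
    DependsOn (fun y => skeletonDiscount A r h y n) (Set.Iio n) := fun y z hyz =>
  Finset.prod_congr rfl fun k hk => by rw [hyz k (Finset.mem_range.1 hk)]

lemma dependsOn_skeletonDiscount_mul (A : Set α) (r f : α → ℝ) (h : ℝ≥0) (n : ℕ) :
    DependsOn (fun y => skeletonDiscount A r h y n * f (y n)) (Set.Iic n) := fun y z hyz => by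
  simp only [dependsOn_skeletonDiscount A r h n fun k hk => hyz k (Set.Iio_subset_Iic_self hk),
    hyz n Set.self_mem_Iic]

/-- The discounted increment of `v` along the step from `y n` to `y (n + 1)`, which is counted only
while `y` has stayed in `A`. -/
def skeletonIncrement (A : Set α) (r v : α → ℝ) (h : ℝ≥0) (y : ℕ → α) (n : ℕ) : ℝ :=
  skeletonDiscount A r h y n *
    A.indicator (fun o => Real.exp (-(h * r o)) * v (y (n + 1)) - v o) (y n)

lemma skeletonIncrement_eq (A : Set α) (r v : α → ℝ) (h : ℝ≥0) (y : ℕ → α) (n : ℕ) :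
    skeletonIncrement A r v h y n = skeletonDiscount A r h y (n + 1) * v (y (n + 1)) -
      skeletonDiscount A r h y n * A.indicator v (y n) := by
  by_cases hy : y n ∈ A
  · simp only [skeletonIncrement, skeletonDiscount_succ, hy, Set.indicator_of_mem]
    ring
  · simp [skeletonIncrement, skeletonDiscount_succ, hy]

lemma sum_skeletonIncrement {A : Set α} {r v : α → ℝ} {h : ℝ≥0} {y : ℕ → α} {m n : ℕ}
    (hmn : m ≤ n) (hy : ∀ k < m, y k ∈ A) (hm : m = n ∨ y m ∉ A) :
    ∑ k ∈ Finset.range n, skeletonIncrement A r v h y k =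
      skeletonDiscount A r h y m * v (y m) - v (y 0) := by
  have hzero : ∀ k ∈ Finset.range n, k ∉ Finset.range m → skeletonIncrement A r v h y k = 0 :=
    fun k hk hk' => by
      rw [Finset.mem_range] at hk hk'
      exact skeletonDiscount_mul_indicator_eq_zero (not_lt.1 hk') (hm.resolve_left (by omega))
  have hone : skeletonDiscount A r h y 0 = 1 := by simp [skeletonDiscount]
  rw [← Finset.sum_subset (Finset.range_mono hmn) hzero, ← one_mul (v (y 0)), ← hone,
    ← Finset.sum_range_sub fun k => skeletonDiscount A r h y k * v (y k)]
  refine Finset.sum_congr rfl fun k hk => ?_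
  have hk := hy k (Finset.mem_range.1 hk)
  rw [skeletonIncrement_eq, Set.indicator_of_mem hk]

lemma exists_first_notMem (A : Set α) (y : ℕ → α) (n : ℕ) :
    ∃ m ≤ n, (∀ k < m, y k ∈ A) ∧ (m = n ∨ y m ∉ A) := by
  classical
  have hex : ∃ m, m = n ∨ y m ∉ A := ⟨n, .inl rfl⟩
  refine ⟨Nat.find hex, Nat.find_min' hex (.inl rfl), fun k hk => ?_, Nat.find_spec hex⟩
  exact not_not.1 fun hkA => Nat.find_min hex hk (.inr hkA)

lemma abs_sum_skeletonIncrement_le (A : Set α) {r v : α → ℝ} {C : ℝ} (hr : ∀ o, 0 ≤ r o)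
    (hv : ∀ o, |v o| ≤ C) (h : ℝ≥0) (y : ℕ → α) (n : ℕ) :
    |∑ k ∈ Finset.range n, skeletonIncrement A r v h y k| ≤ 2 * C := by
  obtain ⟨m, hmn, hy, hm⟩ := exists_first_notMem A y n
  have hprod := abs_skeletonDiscount_mul_le A hr h y m (hv (y m))
  rw [sum_skeletonIncrement hmn hy hm]
  linarith [abs_sub (skeletonDiscount A r h y m * v (y m)) (v (y 0)), hv (y 0)]

variable {A : Set α} {r : α → ℝ} {x : ℝ≥0 → α} {R : ℝ}

/-- The discount factor accumulated by the path `x` at rate `r` up to time `t`. -/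
def pathDiscount (r : α → ℝ) (x : ℝ≥0 → α) (t : ℝ≥0) : ℝ :=
  Real.exp (-∫ s in (0 : ℝ)..t, r (x s.toNNReal))

lemma tendsto_skeletonDiscount (hx : RightConst x) (hR : ∀ o, |r o| ≤ R) {t : ℝ≥0}
    (hA : ∀ s < t, x s ∈ A) :
    Tendsto (fun h : ℝ≥0 => skeletonDiscount A r h (fun k => x (k * h)) ⌈t / h⌉₊) (𝓝[>] 0)
      (𝓝 (pathDiscount r x t)) := by
  have hsum := (hx.comp r).tendsto_riemannSum (fun s => hR _) t
  refine ((Real.continuous_exp.tendsto _).comp hsum.neg).congr fun h => ?_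
  exact (skeletonDiscount_eq_exp fun k hk => hA _ (natCast_mul_lt_of_lt_ceil hk)).symm

lemma tendsto_sum_skeletonIncrement (hx : RightConst x) (hR : ∀ o, |r o| ≤ R) (v : α → ℝ)
    {σ t : ℝ≥0} (hσt : σ ≤ t) (hA : ∀ s < σ, x s ∈ A) (hσ : σ = t ∨ x σ ∉ A) :
    Tendsto (fun h : ℝ≥0 => ∑ k ∈ Finset.range ⌈t / h⌉₊,
        skeletonIncrement A r v h (fun k => x (k * h)) k) (𝓝[>] 0)
      (𝓝 (pathDiscount r x σ * v (x σ) - v (x 0))) := by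
  refine (((tendsto_skeletonDiscount hx hR hA).mul_const (v (x σ))).sub_const _).congr' ?_
  filter_upwards [hx.eventually_ceil_eq σ] with h hh
  rw [sum_skeletonIncrement (m := ⌈σ / h⌉₊) (Nat.ceil_mono (by gcongr))
    (fun k hk => hA _ (natCast_mul_lt_of_lt_ceil hk)) (hσ.imp (by rintro rfl; rfl) fun hn => ?_)]
  · simp only [hh, Nat.cast_zero, zero_mul]
  · rwa [hh]

lemma tendsto_skeletonDiscount_mul_indicator (hx : RightConst x) (hR : ∀ o, |r o| ≤ R)
    {c : ℝ≥0 → α → ℝ} {ψ : α → ℝ} (hc : ∀ o ∈ A, Tendsto (fun h => c h o) (𝓝[>] 0) (𝓝 (ψ o)))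
    (s : ℝ≥0) :
    Tendsto (fun h : ℝ≥0 => skeletonDiscount A r h (fun k => x (k * h)) ⌈s / h⌉₊ *
        A.indicator (c h) (x (⌈s / h⌉₊ * h))) (𝓝[>] 0)
      (𝓝 ({s | ∀ q ≤ s, x q ∈ A}.indicator (fun s => pathDiscount r x s * ψ (x s)) s)) := by
  by_cases hs : ∀ q ≤ s, x q ∈ A
  · rw [Set.indicator_of_mem (by exact hs)]
    refine ((tendsto_skeletonDiscount hx hR fun q hq => hs q hq.le).mul
      (hc _ (hs s le_rfl))).congr' ?_
    filter_upwards [hx.eventually_ceil_eq s] with h hh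
    rw [hh, Set.indicator_of_mem (hs s le_rfl)]
  · rw [Set.indicator_of_notMem (by exact hs)]
    push Not at hs
    obtain ⟨q, hqs, hq⟩ := hs
    refine tendsto_const_nhds.congr' ?_
    filter_upwards [hx.eventually_ceil_eq q] with h hh
    exact (skeletonDiscount_mul_indicator_eq_zero (m := ⌈q / h⌉₊) (Nat.ceil_mono (by gcongr))
      (by simpa only [hh] using hq)).symm

lemma tendsto_sum_skeletonDiscount_mul_indicator (hx : RightConst x) (hr : ∀ o, 0 ≤ r o)
    (hR : ∀ o, |r o| ≤ R) {c : ℝ≥0 → α → ℝ} {ψ : α → ℝ} {C : ℝ}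
    (hc : ∀ o ∈ A, Tendsto (fun h => c h o) (𝓝[>] 0) (𝓝 (ψ o)))
    (hC : ∀ᶠ h in 𝓝[>] 0, ∀ o, |A.indicator (c h) o| ≤ C) (t : ℝ≥0) :
    Tendsto (fun h : ℝ≥0 => h * ∑ k ∈ Finset.range ⌈t / h⌉₊,
        skeletonDiscount A r h (fun k => x (k * h)) k * A.indicator (c h) (x (k * h))) (𝓝[>] 0)
      (𝓝 (∫ s in (0 : ℝ)..t, {s : ℝ≥0 | ∀ q ≤ s, x q ∈ A}.indicator
        (fun s => pathDiscount r x s * ψ (x s)) s.toNNReal)) := by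
  refine tendsto_riemannSum (C := C) ?_ (tendsto_skeletonDiscount_mul_indicator hx hR hc) t
  filter_upwards [hC] with h hh k
  exact abs_skeletonDiscount_mul_le A hr h _ k (hh _)

end StoppedPaths

section Skeleton

variable {Ω : Type*} [MeasurableSpace Ω] {Q : ℕ → ℕ → ℝ} {X : ℝ≥0 → Ω → Option ℕ}
  {P : ℕ → Measure Ω}

local instance : MeasurableSpace (Option ℕ) := ⊤

lemma IsKilledChain.rightConst (hX : IsKilledChain Q X P) (w : Ω) : RightConst fun t => X t w :=
  hX.right_cont w

lemma IsKilledChain.measurable_apply (hX : IsKilledChain Q X P) (t : ℝ≥0) : Measurable (X t) :=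
  measurable_to_countable' fun x => hX.measurable t x

lemma IsKilledChain.measurable_comp_apply (hX : IsKilledChain Q X P) (f : Option ℕ → ℝ) (t : ℝ≥0) :
    Measurable fun w => f (X t w) :=
  (measurable_of_countable f).comp (hX.measurable_apply t)

lemma IsKilledChain.ae_start (hX : IsKilledChain Q X P) (i : ℕ) :
    ∀ᵐ w ∂P i, X 0 w = some i := by
  have : IsProbabilityMeasure (P i) := hX.prob i
  have hstart : (P i).real {w | X 0 w = some i} = 1 := by
    simpa using hX.markov 0 (fun _ => 0) (fun _ => i) monotone_const rfl
  rw [measureReal_def, ENNReal.toReal_eq_one_iff] at hstart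
  exact (prob_compl_eq_zero_iff (hX.measurable 0 (some i))).2 hstart

/-- The transition function started from a point of `E ∪ {∂}`. -/
def transProbFrom (X : ℝ≥0 → Ω → Option ℕ) (P : ℕ → Measure Ω) (t : ℝ≥0) (o : Option ℕ) (l : ℕ) :
    ℝ := o.elim 0 fun k => transProb X P t k l

lemma transProbFrom_nonneg (X : ℝ≥0 → Ω → Option ℕ) (P : ℕ → Measure Ω) (t : ℝ≥0) (o : Option ℕ)
    (l : ℕ) : 0 ≤ transProbFrom X P t o l := by
  cases o
  · exact le_rfl
  · exact measureReal_nonneg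

lemma IsKilledChain.abs_transProbFrom_le_one (hX : IsKilledChain Q X P) (t : ℝ≥0) (o : Option ℕ)
    (l : ℕ) : |transProbFrom X P t o l| ≤ 1 := by
  rw [abs_of_nonneg (transProbFrom_nonneg ..)]
  rcases o with _ | k
  · exact zero_le_one
  · have : IsProbabilityMeasure (P k) := hX.prob k
    exact measureReal_le_one

lemma IsKilledChain.real_live_cylinder_succ (hX : IsKilledChain Q X P) (i l : ℕ) {t : ℕ → ℝ≥0}
    (ht : Monotone t) (ht0 : t 0 = 0) (m : ℕ) (x : ℕ → ℕ) :
    (P i).real {w | (∀ k ≤ m, X (t k) w = some (x k)) ∧ X (t (m + 1)) w = some l} =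
      transProb X P (t (m + 1) - t m) (x m) l *
        (P i).real {w | ∀ k ≤ m, X (t k) w = some (x k)} := by
  rcases eq_or_ne (x 0) i with rfl | hne
  · set y : ℕ → ℕ := fun k => if k ≤ m then x k else l
    have hy : ∀ k ≤ m, y k = x k := fun k hk => if_pos hk
    have hsucc := hX.markov (m + 1) t y ht ht0
    have hm := hX.markov m t x ht ht0
    rw [Finset.prod_range_succ, hy 0 m.zero_le, hy m le_rfl,
      show y (m + 1) = l by simp [y]] at hsucc
    have hprod : ∀ k ∈ Finset.range m, transProb X P (t (k + 1) - t k) (y k) (y (k + 1)) =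
        transProb X P (t (k + 1) - t k) (x k) (x (k + 1)) := fun k hk => by
      rw [hy k (Finset.mem_range.1 hk).le, hy (k + 1) (Finset.mem_range.1 hk)]
    rw [hm, mul_comm, ← Finset.prod_congr rfl hprod, ← hsucc]
    congr 1
    ext w
    simp only [Set.mem_ofPred_eq, Nat.le_succ_iff, or_imp, forall_and, forall_eq]
    refine and_congr (forall₂_congr fun k hk => by rw [hy k hk]) (by simp [y])
  · have hnull : (P i) {w | ∀ k ≤ m, X (t k) w = some (x k)} = 0 := by
      refine measure_mono_null (fun w hw => ?_) (ae_iff.1 (hX.ae_start i))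
      have := hw 0 m.zero_le
      rw [ht0] at this
      simpa [this] using hne
    rw [measureReal_def, measureReal_def, hnull, measure_mono_null (fun w hw => hw.1) hnull,
      ENNReal.toReal_zero, mul_zero]

lemma IsKilledChain.real_cylinder_succ (hX : IsKilledChain Q X P) (i l : ℕ) {t : ℕ → ℝ≥0}
    (ht : Monotone t) (ht0 : t 0 = 0) (m : ℕ) (z : ℕ → Option ℕ) :
    (P i).real {w | (∀ k ≤ m, X (t k) w = z k) ∧ X (t (m + 1)) w = some l} =
      transProbFrom X P (t (m + 1) - t m) (z m) l *
        (P i).real {w | ∀ k ≤ m, X (t k) w = z k} := by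
  have hdead : ∀ w, (∀ k ≤ m, X (t k) w = z k) → ∀ k ≤ m, z k = none →
      z m = none ∧ X (t (m + 1)) w = none := fun w hw k hkm hk => by
    have hXk := (hw k hkm).trans hk
    exact ⟨hw m le_rfl ▸ hX.absorbed w _ _ (ht hkm) hXk,
      hX.absorbed w _ _ (ht (hkm.trans m.le_succ)) hXk⟩
  rcases hzm : z m with _ | y
  · have hleft : {w | (∀ k ≤ m, X (t k) w = z k) ∧ X (t (m + 1)) w = some l} = ∅ :=
      Set.eq_empty_of_forall_notMem fun w hw => by simpa [hdead w hw.1 m le_rfl hzm] using hw.2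
    simp [hleft, transProbFrom]
  by_cases hz : ∀ k ≤ m, z k ≠ none
  · have hx : ∀ k ≤ m, z k = some ((z k).getD 0) := fun k hk => by
      obtain ⟨_, hy⟩ := Option.ne_none_iff_exists'.1 (hz k hk)
      simp [hy]
    have hcyl : ∀ w, (∀ k ≤ m, X (t k) w = z k) ↔ ∀ k ≤ m, X (t k) w = some ((z k).getD 0) :=
      fun w => forall₂_congr fun k hk => by rw [← hx k hk]
    simp only [hcyl, hX.real_live_cylinder_succ i l ht ht0 m fun k => (z k).getD 0, hzm,
      transProbFrom, Option.getD_some, Option.elim_some]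
  · push Not at hz
    obtain ⟨k, hkm, hk⟩ := hz
    have hempty : ∀ w, ¬∀ k ≤ m, X (t k) w = z k := fun w hw => by
      simpa [hzm] using (hdead w hw k hkm hk).1
    simp [hempty]

lemma IsKilledChain.map_skeleton_restrict (hX : IsKilledChain Q X P) (i l : ℕ) {t : ℕ → ℝ≥0}
    (ht : Monotone t) (ht0 : t 0 = 0) (m : ℕ) :
    ((P i).restrict {w | X (t (m + 1)) w = some l}).map (fun w (k : Fin (m + 1)) => X (t k) w) =
      ((P i).map fun w (k : Fin (m + 1)) => X (t k) w).withDensity fun z =>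
        ENNReal.ofReal (transProbFrom X P (t (m + 1) - t m) (z (Fin.last m)) l) := by
  have : IsProbabilityMeasure (P i) := hX.prob i
  have hY : Measurable fun w (k : Fin (m + 1)) => X (t k) w :=
    measurable_pi_lambda _ fun k => hX.measurable_apply (t k)
  refine Measure.ext_of_singleton fun z => ?_
  have hpre : (fun w (k : Fin (m + 1)) => X (t k) w) ⁻¹' {z} =
      {w | ∀ k ≤ m, X (t k) w = z (Fin.ofNat (m + 1) k)} := by
    ext w
    simp only [Set.mem_preimage, Set.mem_singleton_iff, funext_iff, Fin.forall_iff,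
      Nat.lt_succ_iff, Set.mem_ofPred_eq]
    refine forall₂_congr fun k hk => ?_
    rw [show Fin.ofNat (m + 1) k = ⟨k, Nat.lt_succ_of_le hk⟩ from
      Fin.ext (Nat.mod_eq_of_lt (Nat.lt_succ_of_le hk))]
  have hlast : Fin.ofNat (m + 1) m = Fin.last m := Fin.ext (Nat.mod_eq_of_lt m.lt_succ_self)
  have hcyl := hX.real_cylinder_succ i l ht ht0 m fun k => z (Fin.ofNat (m + 1) k)
  rw [hlast] at hcyl
  rw [Measure.map_apply hY (measurableSet_singleton z), withDensity_apply _
    (measurableSet_singleton z), lintegral_singleton, Measure.map_apply hY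
    (measurableSet_singleton z), Measure.restrict_apply (hY (measurableSet_singleton z)), hpre,
    ← ofReal_measureReal, ← ofReal_measureReal, ← ENNReal.ofReal_mul (transProbFrom_nonneg ..),
    ← hcyl]
  rfl

lemma apply_ofNat_eq_of_dependsOn {F : (ℕ → Option ℕ) → ℝ} {m : ℕ} (hF : DependsOn F (Set.Iic m))
    (y : ℕ → Option ℕ) : F (fun k => y (Fin.ofNat (m + 1) k : Fin (m + 1))) = F y :=
  hF fun _ hk => congrArg y (Nat.mod_eq_of_lt (Nat.lt_succ_of_le hk))

lemma IsKilledChain.measurable_skeleton (hX : IsKilledChain Q X P) (t : ℕ → ℝ≥0) {m : ℕ}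
    {F : (ℕ → Option ℕ) → ℝ} (hF : DependsOn F (Set.Iic m)) :
    Measurable fun w => F fun k => X (t k) w := by
  have hY : Measurable fun w (k : Fin (m + 1)) => X (t k) w :=
    measurable_pi_lambda _ fun k => hX.measurable_apply (t k)
  simp only [← apply_ofNat_eq_of_dependsOn hF fun k => X (t k) _]
  exact (measurable_of_countable fun z : Fin (m + 1) → Option ℕ =>
    F fun k => z (Fin.ofNat (m + 1) k)).comp hY

lemma IsKilledChain.integrable_skeleton (hX : IsKilledChain Q X P) (i : ℕ) (t : ℕ → ℝ≥0) {m : ℕ}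
    {F : (ℕ → Option ℕ) → ℝ} (hF : DependsOn F (Set.Iic m)) {C : ℝ} (hC : ∀ y, |F y| ≤ C) :
    Integrable (fun w => F fun k => X (t k) w) (P i) := by
  have : IsProbabilityMeasure (P i) := hX.prob i
  exact .of_bound (hX.measurable_skeleton t hF).aestronglyMeasurable C (ae_of_all _ fun _ => hC _)

lemma IsKilledChain.setIntegral_skeleton_succ (hX : IsKilledChain Q X P) (i l : ℕ)
    {t : ℕ → ℝ≥0} (ht : Monotone t) (ht0 : t 0 = 0) {m : ℕ} {F : (ℕ → Option ℕ) → ℝ}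
    (hF : DependsOn F (Set.Iic m)) :
    ∫ w in {w | X (t (m + 1)) w = some l}, F (fun k => X (t k) w) ∂P i =
      ∫ w, transProbFrom X P (t (m + 1) - t m) (X (t m) w) l * F (fun k => X (t k) w) ∂P i := by
  set f : (Fin (m + 1) → Option ℕ) → ℝ := fun z => F fun k => z (Fin.ofNat (m + 1) k)
  have hY : Measurable fun w (k : Fin (m + 1)) => X (t k) w :=
    measurable_pi_lambda _ fun k => hX.measurable_apply (t k)
  have hf : ∀ w, F (fun k => X (t k) w) = f fun k => X (t k) w := fun w =>
    (apply_ofNat_eq_of_dependsOn hF fun k => X (t k) w).symm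
  simp only [hf]
  rw [← integral_map hY.aemeasurable (measurable_of_countable f).aestronglyMeasurable,
    hX.map_skeleton_restrict i l ht ht0, integral_withDensity_eq_integral_toReal_smul
      (measurable_of_countable _) (ae_of_all _ fun _ => ENNReal.ofReal_lt_top),
    integral_map hY.aemeasurable (measurable_of_countable _).aestronglyMeasurable]
  simp only [ENNReal.toReal_ofReal (transProbFrom_nonneg ..), Fin.val_last, smul_eq_mul]

/-- The transition operator `v ↦ 𝔼[v(X_t)]` from a point of `E ∪ {∂}`, on functions that take the
value `v(∂)` on all of `[N, ∞)`. -/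
def transOp (X : ℝ≥0 → Ω → Option ℕ) (P : ℕ → Measure Ω) (N : ℕ) (t : ℝ≥0) (v : Option ℕ → ℝ)
    (o : Option ℕ) : ℝ :=
  v none + ∑ l ∈ Finset.range N, (v (some l) - v none) * transProbFrom X P t o l

lemma eq_none_add_sum_indicator {v : Option ℕ → ℝ} {N : ℕ} (hv : ∀ l, N ≤ l → v (some l) = v none)
    (o : Option ℕ) :
    v o = v none + ∑ l ∈ Finset.range N,
      (v (some l) - v none) * ({some l} : Set (Option ℕ)).indicator 1 o := by
  rcases o with _ | k
  · simp
  · simp only [Set.indicator_apply, Set.mem_singleton_iff, Option.some_inj, Pi.one_apply,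
      mul_ite, mul_one, mul_zero, Finset.sum_ite_eq, Finset.mem_range]
    split_ifs with hk
    · ring
    · rw [hv k (not_lt.1 hk), add_zero]

lemma IsKilledChain.integral_mul_apply_succ (hX : IsKilledChain Q X P) (i : ℕ) {t : ℕ → ℝ≥0}
    (ht : Monotone t) (ht0 : t 0 = 0) {m : ℕ} {F : (ℕ → Option ℕ) → ℝ}
    (hF : DependsOn F (Set.Iic m)) {C : ℝ} (hC : ∀ y, |F y| ≤ C) {v : Option ℕ → ℝ} {N : ℕ}
    (hv : ∀ l, N ≤ l → v (some l) = v none) :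
    ∫ w, F (fun k => X (t k) w) * v (X (t (m + 1)) w) ∂P i =
      ∫ w, F (fun k => X (t k) w) * transOp X P N (t (m + 1) - t m) v (X (t m) w) ∂P i := by
  have hFi := hX.integrable_skeleton i t hF hC
  have hind : ∀ l w, F (fun k => X (t k) w) *
      ({some l} : Set (Option ℕ)).indicator 1 (X (t (m + 1)) w) =
      {w | X (t (m + 1)) w = some l}.indicator (fun w => F fun k => X (t k) w) w := fun l w => by
    by_cases hl : X (t (m + 1)) w = some l <;> simp [hl]
  have hpi : ∀ l, Integrable (fun w => transProbFrom X P (t (m + 1) - t m) (X (t m) w) l *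
      F fun k => X (t k) w) (P i) := fun l =>
    hFi.bdd_mul (c := 1)
      (hX.measurable_comp_apply (fun o => transProbFrom X P _ o l) _).aestronglyMeasurable
      (ae_of_all _ fun w => hX.abs_transProbFrom_le_one _ _ l)
  have hexp : ∀ w (p : ℕ → ℝ), F (fun k => X (t k) w) * (v none + ∑ l ∈ Finset.range N,
      (v (some l) - v none) * p l) = v none * F (fun k => X (t k) w) + ∑ l ∈ Finset.range N,
      (v (some l) - v none) * (F (fun k => X (t k) w) * p l) := fun w p => by
    rw [mul_add, Finset.mul_sum, mul_comm]
    exact congrArg _ (Finset.sum_congr rfl fun _ _ => by ring)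
  simp only [transOp, eq_none_add_sum_indicator hv (X (t (m + 1)) _), hexp, hind,
    mul_comm (F _) (transProbFrom ..)]
  rw [integral_add (hFi.const_mul _) (integrable_finsetSum _ fun l _ =>
    ((hFi.indicator (hX.measurable _ _)).const_mul _)),
    integral_add (hFi.const_mul _) (integrable_finsetSum _ fun l _ => (hpi l).const_mul _),
    integral_finsetSum _ fun l _ => (hFi.indicator (hX.measurable _ _)).const_mul _,
    integral_finsetSum _ fun l _ => (hpi l).const_mul _]
  simp only [integral_const_mul, integral_indicator (hX.measurable _ _),
    hX.setIntegral_skeleton_succ i _ ht ht0 hF]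

/-- The difference quotient over a time step `h` of the semigroup killed at rate `r`. -/
def killedDiffQuot (X : ℝ≥0 → Ω → Option ℕ) (P : ℕ → Measure Ω) (N : ℕ) (r v : Option ℕ → ℝ)
    (h : ℝ≥0) (o : Option ℕ) : ℝ :=
  (Real.exp (-(h * r o)) * transOp X P N h v o - v o) / h

lemma IsKilledChain.integrable_transOp (hX : IsKilledChain Q X P) (i N : ℕ) (s t : ℝ≥0)
    (v : Option ℕ → ℝ) : Integrable (fun w => transOp X P N t v (X s w)) (P i) := by
  have : IsProbabilityMeasure (P i) := hX.prob i
  refine (integrable_const _).add (integrable_finsetSum _ fun l _ => Integrable.const_mul ?_ _)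
  exact .of_bound
    (hX.measurable_comp_apply (fun o => transProbFrom X P t o l) s).aestronglyMeasurable 1
    (ae_of_all _ fun w => hX.abs_transProbFrom_le_one _ _ l)

lemma skeletonDiscount_mul_killedDiffQuot (X : ℝ≥0 → Ω → Option ℕ) (P : ℕ → Measure Ω)
    (A : Set (Option ℕ)) (r v : Option ℕ → ℝ) (N : ℕ) {h : ℝ≥0} (hh : h ≠ 0) (y : ℕ → Option ℕ)
    (m : ℕ) :
    h * (skeletonDiscount A r h y m * A.indicator (killedDiffQuot X P N r v h) (y m)) =
      skeletonDiscount A r h y (m + 1) * transOp X P N h v (y m) -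
        skeletonDiscount A r h y m * A.indicator v (y m) := by
  have hh' : (h : ℝ) ≠ 0 := by exact_mod_cast hh
  by_cases hy : y m ∈ A
  · simp only [skeletonDiscount_succ, killedDiffQuot, hy, Set.indicator_of_mem]
    field_simp
  · simp [skeletonDiscount_succ, hy]

lemma IsKilledChain.integrable_skeletonDiscount_mul (hX : IsKilledChain Q X P) (i : ℕ)
    (A : Set (Option ℕ)) {r f : Option ℕ → ℝ} (hr : ∀ o, 0 ≤ r o) {C : ℝ} (hC : ∀ o, |f o| ≤ C)
    (h : ℝ≥0) (m : ℕ) :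
    Integrable (fun w => skeletonDiscount A r h (fun k => X (k * h) w) m * f (X (m * h) w))
      (P i) :=
  hX.integrable_skeleton i (fun k => k * h) (dependsOn_skeletonDiscount_mul A r f h m)
    fun y => abs_skeletonDiscount_mul_le A hr h y m (hC _)

lemma IsKilledChain.integrable_skeletonIncrement (hX : IsKilledChain Q X P) (i : ℕ)
    (A : Set (Option ℕ)) {r v : Option ℕ → ℝ} (hr : ∀ o, 0 ≤ r o) {C : ℝ} (hC : ∀ o, |v o| ≤ C)
    (h : ℝ≥0) (m : ℕ) :
    Integrable (fun w => skeletonIncrement A r v h (fun k => X (k * h) w) m) (P i) := by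
  simp only [skeletonIncrement_eq]
  exact (hX.integrable_skeletonDiscount_mul i A hr hC h (m + 1)).sub
    (hX.integrable_skeletonDiscount_mul i A hr (abs_indicator_le A hC) h m)

lemma IsKilledChain.integral_skeletonIncrement (hX : IsKilledChain Q X P) (i : ℕ)
    (A : Set (Option ℕ)) {r v : Option ℕ → ℝ} (hr : ∀ o, 0 ≤ r o) {C : ℝ} (hC : ∀ o, |v o| ≤ C)
    {N : ℕ} (hv : ∀ l, N ≤ l → v (some l) = v none) {h : ℝ≥0} (hh : h ≠ 0) (m : ℕ) :
    ∫ w, skeletonIncrement A r v h (fun k => X (k * h) w) m ∂P i =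
      ∫ w, h * (skeletonDiscount A r h (fun k => X (k * h) w) m *
        A.indicator (killedDiffQuot X P N r v h) (X (m * h) w)) ∂P i := by
  let D : (ℕ → Option ℕ) → ℝ := fun y => skeletonDiscount A r h y (m + 1)
  have hmono : Monotone fun k : ℕ => (k : ℝ≥0) * h := fun k l hkl => by dsimp only; gcongr
  have hstep : ((m + 1 : ℕ) : ℝ≥0) * h - m * h = h := by
    rw [Nat.cast_succ, add_mul, one_mul, add_tsub_cancel_left]
  have hdep : DependsOn D (Set.Iic m) :=
    Set.Iio_add_one_eq_Iic m ▸ dependsOn_skeletonDiscount A r h (m + 1)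
  have hD1 : ∀ y, |D y| ≤ 1 := fun y =>
    (abs_of_nonneg (skeletonDiscount_nonneg A r h y _)).trans_le (skeletonDiscount_le_one A hr ..)
  have hmarkov := hX.integral_mul_apply_succ i hmono (by simp) hdep hD1 hv
  rw [hstep] at hmarkov
  have hVi := hX.integrable_skeletonDiscount_mul i A hr (abs_indicator_le A hC) h m
  have hTi := (hX.integrable_transOp i N (m * h) h v).bdd_mul
    (hX.measurable_skeleton (fun k => k * h) hdep).aestronglyMeasurable (ae_of_all _ fun _ => hD1 _)
  simp only [skeletonIncrement_eq]
  rw [integral_sub (hX.integrable_skeletonDiscount_mul i A hr hC h (m + 1)) hVi, hmarkov,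
    ← integral_sub hTi hVi]
  exact integral_congr_ae <| ae_of_all _ fun w =>
    (skeletonDiscount_mul_killedDiffQuot X P A r v N hh (fun k => X (k * h) w) m).symm

lemma IsKilledChain.integral_sum_skeletonIncrement (hX : IsKilledChain Q X P) (i : ℕ)
    (A : Set (Option ℕ)) {r v : Option ℕ → ℝ} (hr : ∀ o, 0 ≤ r o) {C : ℝ} (hC : ∀ o, |v o| ≤ C)
    {N : ℕ} (hv : ∀ l, N ≤ l → v (some l) = v none) {h : ℝ≥0} (hh : h ≠ 0) {K : ℝ}
    (hK : ∀ o, |A.indicator (killedDiffQuot X P N r v h) o| ≤ K) (n : ℕ) :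
    ∫ w, ∑ m ∈ Finset.range n, skeletonIncrement A r v h (fun k => X (k * h) w) m ∂P i =
      ∫ w, h * ∑ m ∈ Finset.range n, skeletonDiscount A r h (fun k => X (k * h) w) m *
        A.indicator (killedDiffQuot X P N r v h) (X (m * h) w) ∂P i := by
  simp only [Finset.mul_sum]
  rw [integral_finsetSum _ fun m _ => hX.integrable_skeletonIncrement i A hr hC h m,
    integral_finsetSum _ fun m _ => (hX.integrable_skeletonDiscount_mul i A hr hK h m).const_mul _]
  exact Finset.sum_congr rfl fun m _ => hX.integral_skeletonIncrement i A hr hC hv hh m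

end Skeleton

section Generator

variable {Ω : Type*} [MeasurableSpace Ω] {Q : ℕ → ℕ → ℝ} {X : ℝ≥0 → Ω → Option ℕ}
  {P : ℕ → Measure Ω}

/-- The generator `Q - g` of the chain killed at the additional rate `g`, on functions `v` on
`E ∪ {∂}` that take the value `v(∂)` on all of `[N, ∞)`. As the jump rates out of `x` into `E ∪ {∂}`
add up to zero, `Q` acts on `v` as it does on `v - v(∂)`, which leaves a finite sum. -/
def generator (Q : ℕ → ℕ → ℝ) (g : ℕ → ℝ) (N : ℕ) : (Option ℕ → ℝ) →ₗ[ℝ] (ℕ → ℝ) where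
  toFun v x := ∑ l ∈ Finset.range N, Q x l * (v (some l) - v none) - g x * v (some x)
  map_add' u v := by
    ext x
    simp only [Pi.add_apply, add_sub_add_comm, mul_add, Finset.sum_add_distrib]
  map_smul' b v := by
    ext x
    simp only [Pi.smul_apply, smul_eq_mul, RingHom.id_apply, mul_sub, Finset.mul_sum,
      mul_left_comm b]

lemma generator_apply (Q : ℕ → ℕ → ℝ) (g : ℕ → ℝ) (N : ℕ) (v : Option ℕ → ℝ) (x : ℕ) :
    generator Q g N v x =
      ∑ l ∈ Finset.range N, Q x l * (v (some l) - v none) - g x * v (some x) := rfl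

lemma IsKilledChain.tendsto_transOp_sub_div (hX : IsKilledChain Q X P) {v : Option ℕ → ℝ} {N : ℕ}
    (hv : ∀ l, N ≤ l → v (some l) = v none) (x : ℕ) :
    Tendsto (fun h : ℝ≥0 => (transOp X P N h v (some x) - v (some x)) / h) (𝓝[>] 0)
      (𝓝 (∑ l ∈ Finset.range N, Q x l * (v (some l) - v none))) := by
  refine (tendsto_finsetSum _ fun l _ => (hX.rates x l).mul_const _).congr fun h => ?_
  rw [transOp, eq_none_add_sum_indicator hv (some x), add_sub_add_left_eq_sub,
    ← Finset.sum_sub_distrib, Finset.sum_div]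
  refine Finset.sum_congr rfl fun l _ => ?_
  simp only [transProbFrom, Option.elim_some, Set.indicator_apply, Set.mem_singleton_iff,
    Option.some_inj, Pi.one_apply]
  ring

lemma tendsto_exp_neg_mul_sub_one_div (b : ℝ) :
    Tendsto (fun h : ℝ≥0 => (Real.exp (-(h * b)) - 1) / h) (𝓝[>] 0) (𝓝 (-b)) := by
  have hcoe : Tendsto (fun h : ℝ≥0 => (h : ℝ)) (𝓝[>] 0) (𝓝[≠] 0) :=
    tendsto_nhdsWithin_iff.2 ⟨tendsto_nhdsWithin_of_tendsto_nhds (NNReal.continuous_coe.tendsto 0),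
      eventually_mem_nhdsWithin.mono fun h hh => NNReal.coe_ne_zero.2 (ne_of_gt hh)⟩
  have hderiv : HasDerivAt (fun y : ℝ => Real.exp (-(y * b))) (-b) 0 := by
    simpa using ((hasDerivAt_id (0 : ℝ)).mul_const b).neg.exp
  refine (hderiv.tendsto_slope.comp hcoe).congr fun h => ?_
  simp [slope, div_eq_inv_mul]

lemma IsKilledChain.tendsto_killedDiffQuot (hX : IsKilledChain Q X P) {r v : Option ℕ → ℝ} {N : ℕ}
    (hv : ∀ l, N ≤ l → v (some l) = v none) {g : ℕ → ℝ} {x : ℕ} (hr : r (some x) = g x) :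
    Tendsto (fun h => killedDiffQuot X P N r v h (some x)) (𝓝[>] 0) (𝓝 (generator Q g N v x)) := by
  have hexp : Tendsto (fun h : ℝ≥0 => Real.exp (-(h * g x))) (𝓝[>] 0) (𝓝 1) := by
    have hcont : Continuous fun h : ℝ≥0 => Real.exp (-(h * g x)) := by fun_prop
    simpa using tendsto_nhdsWithin_of_tendsto_nhds (hcont.tendsto 0)
  have hlim := (hexp.mul (hX.tendsto_transOp_sub_div hv x)).add
    ((tendsto_exp_neg_mul_sub_one_div (g x)).mul_const (v (some x)))
  rw [one_mul, neg_mul, ← sub_eq_add_neg] at hlim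
  refine hlim.congr fun h => ?_
  rw [killedDiffQuot, hr]
  ring

lemma IsKilledChain.eventually_abs_killedDiffQuot_le (hX : IsKilledChain Q X P)
    {r v : Option ℕ → ℝ} {N : ℕ} (hv : ∀ l, N ≤ l → v (some l) = v none) {g : ℕ → ℝ} {S : Finset ℕ}
    (hr : ∀ x ∈ S, r (some x) = g x) :
    ∃ K, ∀ᶠ h in 𝓝[>] 0, ∀ o,
      |(some '' (S : Set ℕ)).indicator (killedDiffQuot X P N r v h) o| ≤ K := by
  refine ⟨∑ x ∈ S, (|generator Q g N v x| + 1), ?_⟩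
  have hone : ∀ x ∈ S, ∀ᶠ h in 𝓝[>] 0,
      |killedDiffQuot X P N r v h (some x)| ≤ |generator Q g N v x| + 1 := fun x hx =>
    (hX.tendsto_killedDiffQuot hv (hr x hx)).abs.eventually_le_const (lt_add_one _)
  filter_upwards [S.eventually_all.2 hone] with h hh o
  have hpos : ∀ x ∈ S, 0 ≤ |generator Q g N v x| + 1 := fun x _ => by positivity
  by_cases ho : o ∈ some '' (S : Set ℕ)
  · obtain ⟨x, hx, rfl⟩ := id ho
    rw [Set.indicator_of_mem ho]
    exact (hh x hx).trans (Finset.single_le_sum hpos hx)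
  · rw [Set.indicator_of_notMem ho, abs_zero]
    exact Finset.sum_nonneg hpos

end Generator

section ExitTimes

/-! ### Exit times -/

variable {Ω : Type*} {X : ℝ≥0 → Ω → Option ℕ} {w : Ω}

lemma lt_entryTime_iff (hx : RightConst fun t => X t w) (F : Set (Option ℕ)) (t : ℝ≥0) :
    (t : ℝ≥0∞) < entryTime X F w ↔ ∀ s ≤ t, X s w ∉ F := by
  refine ⟨fun ht s hs hF => (ht.trans_le (iInf₂_le s hF)).not_ge (by exact_mod_cast hs),
    fun h => ?_⟩
  obtain ⟨u, htu, hu⟩ : ∃ u > t, ∀ s ∈ Set.Ico t u, X s w = X t w :=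
    mem_nhdsGE_iff_exists_Ico_subset.1 (hx t)
  refine (ENNReal.coe_lt_coe.2 htu).trans_le (le_iInf₂ fun s hs => ?_)
  by_contra! hsu
  rcases le_total s t with hst | hts
  · exact h s hst hs
  · exact h t le_rfl (hu s ⟨hts, ENNReal.coe_lt_coe.1 hsu⟩ ▸ hs)

lemma entryTime_union (X : ℝ≥0 → Ω → Option ℕ) (F G : Set (Option ℕ)) (w : Ω) :
    entryTime X (F ∪ G) w = min (entryTime X F w) (entryTime X G w) := by
  simp only [entryTime, Set.mem_union, iInf_or, iInf_inf_eq]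

lemma apply_entryTime_mem (hx : RightConst fun t => X t w) {F : Set (Option ℕ)} {t : ℝ≥0}
    (ht : entryTime X F w = t) : X t w ∈ F := by
  have hle := (lt_entryTime_iff hx F t).not.1 ht.not_gt
  push Not at hle
  obtain ⟨s, hst, hs⟩ := hle
  have hts : (t : ℝ≥0∞) ≤ s := ht ▸ iInf₂_le s hs
  rwa [le_antisymm (ENNReal.coe_le_coe.1 hts) hst]

lemma entryTime_lt_entryTime_iff (hx : RightConst fun t => X t w) {F G : Set (Option ℕ)}
    (hFG : Disjoint F G) {t : ℝ≥0} (ht : entryTime X (F ∪ G) w = t) :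
    entryTime X F w < entryTime X G w ↔ X t w ∈ F := by
  rw [entryTime_union] at ht
  refine ⟨fun hlt => apply_entryTime_mem hx ((min_eq_left hlt.le).symm.trans ht), fun hF => ?_⟩
  refine lt_of_le_of_ne ?_ fun heq => ?_
  · exact (iInf₂_le t hF).trans (ht.symm.trans_le (min_le_right _ _))
  · exact hFG.le_bot ⟨hF, apply_entryTime_mem hx (by rwa [heq, min_self] at ht)⟩

/-- The exit time from a finite set `S` of live states. -/
def exitTime (X : ℝ≥0 → Ω → Option ℕ) (S : Finset ℕ) (w : Ω) : ℝ≥0∞ :=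
  entryTime X (some '' (S : Set ℕ))ᶜ w

lemma lt_exitTime_iff (hx : RightConst fun t => X t w) (S : Finset ℕ) (t : ℝ≥0) :
    (t : ℝ≥0∞) < exitTime X S w ↔ ∀ s ≤ t, X s w ∈ some '' (S : Set ℕ) := by
  simp only [exitTime, lt_entryTime_iff hx, Set.notMem_compl_iff]

/-- The exit time from `S`, capped at `t`. -/
def cappedExitTime (X : ℝ≥0 → Ω → Option ℕ) (S : Finset ℕ) (t : ℝ≥0) (w : Ω) : ℝ≥0 :=
  (min (exitTime X S w) t).toNNReal

lemma coe_cappedExitTime (X : ℝ≥0 → Ω → Option ℕ) (S : Finset ℕ) (t : ℝ≥0) (w : Ω) :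
    (cappedExitTime X S t w : ℝ≥0∞) = min (exitTime X S w) t :=
  ENNReal.coe_toNNReal (ne_top_of_le_ne_top ENNReal.coe_ne_top (min_le_right _ _))

lemma cappedExitTime_le (X : ℝ≥0 → Ω → Option ℕ) (S : Finset ℕ) (t : ℝ≥0) (w : Ω) :
    cappedExitTime X S t w ≤ t :=
  ENNReal.coe_le_coe.1 ((coe_cappedExitTime X S t w).trans_le (min_le_right _ _))

lemma apply_mem_of_lt_cappedExitTime (hx : RightConst fun t => X t w) {S : Finset ℕ} {s t : ℝ≥0}
    (hs : s < cappedExitTime X S t w) : X s w ∈ some '' (S : Set ℕ) := by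
  rw [← ENNReal.coe_lt_coe, coe_cappedExitTime, lt_min_iff] at hs
  exact (lt_exitTime_iff hx S s).1 hs.1 s le_rfl

lemma cappedExitTime_eq_or_notMem (hx : RightConst fun t => X t w) (S : Finset ℕ) (t : ℝ≥0) :
    cappedExitTime X S t w = t ∨ X (cappedExitTime X S t w) w ∉ some '' (S : Set ℕ) := by
  rcases le_total (t : ℝ≥0∞) (exitTime X S w) with h | h
  · left
    rw [cappedExitTime, min_eq_right h, ENNReal.toNNReal_coe]
  · right
    refine apply_entryTime_mem hx (F := (some '' (S : Set ℕ))ᶜ) ?_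
    rw [coe_cappedExitTime, min_eq_left h, exitTime]

end ExitTimes

section TimeIntegrals

lemma measurableSet_setOf_ofReal_lt (T : ℝ≥0∞) :
    MeasurableSet {t : ℝ | 0 ≤ t ∧ ENNReal.ofReal t < T} :=
  measurableSet_Ici.inter (measurableSet_lt ENNReal.measurable_ofReal measurable_const)

lemma timeIntegral_congr {T : ℝ≥0∞} {f g : ℝ≥0 → ℝ≥0∞}
    (h : ∀ t : ℝ≥0, (t : ℝ≥0∞) < T → f t = g t) : timeIntegral T f = timeIntegral T g :=
  setLIntegral_congr_fun (measurableSet_setOf_ofReal_lt T) fun t ht => h t.toNNReal ht.2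

lemma timeIntegral_mono_left {S T : ℝ≥0∞} (hST : S ≤ T) (f : ℝ≥0 → ℝ≥0∞) :
    timeIntegral S f ≤ timeIntegral T f :=
  lintegral_mono_set fun _ ht => ⟨ht.1, ht.2.trans_le hST⟩

lemma timeIntegral_top_one : timeIntegral ⊤ (fun _ => 1) = ⊤ := by
  have hset : {t : ℝ | 0 ≤ t ∧ ENNReal.ofReal t < ⊤} = Set.Ici 0 := by ext; simp
  rw [timeIntegral, setLIntegral_one, hset, Real.volume_Ici]

lemma ofReal_intervalIntegral_indicator (T : ℝ≥0∞) (t : ℝ≥0) {f : ℝ≥0 → ℝ} {C : ℝ}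
    (hf : Measurable f)
    (h0 : ∀ s : ℝ≥0, (s : ℝ≥0∞) < T → 0 ≤ f s)
    (hC : ∀ s : ℝ≥0, (s : ℝ≥0∞) < T → f s ≤ C) :
    ENNReal.ofReal (∫ s in (0 : ℝ)..t, {s : ℝ≥0 | (s : ℝ≥0∞) < T}.indicator f s.toNNReal) =
      timeIntegral (min T t) fun s => ENNReal.ofReal (f s) := by
  have hmeas : Measurable fun s : ℝ => {s : ℝ≥0 | (s : ℝ≥0∞) < T}.indicator f s.toNNReal :=
    (hf.indicator (measurableSet_lt measurable_coe_nnreal_ennreal measurable_const)).comp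
      measurable_real_toNNReal
  have hset : {s : ℝ | 0 ≤ s ∧ ENNReal.ofReal s < min T t} =
      {s : ℝ | ENNReal.ofReal s < T} ∩ Set.Ico 0 (t : ℝ) := by
    ext s
    rw [← ENNReal.ofReal_coe_nnreal]
    simp only [Set.mem_ofPred_eq, lt_min_iff, Set.mem_inter_iff, Set.mem_Ico]
    refine ⟨fun ⟨hs, hsT, hst⟩ => ⟨hsT, hs, (ENNReal.ofReal_lt_ofReal_iff_of_nonneg hs).1 hst⟩,
      fun ⟨hsT, hs, hst⟩ => ⟨hs, hsT, (ENNReal.ofReal_lt_ofReal_iff_of_nonneg hs).2 hst⟩⟩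
  have hbound : ∀ s : ℝ, |{s : ℝ≥0 | (s : ℝ≥0∞) < T}.indicator f s.toNNReal| ≤ |C| := fun s => by
    have hnonneg := Set.indicator_nonneg (s := {s : ℝ≥0 | (s : ℝ≥0∞) < T}) h0 s.toNNReal
    rw [abs_of_nonneg hnonneg]
    exact Set.indicator_apply_le' (fun hs => (hC _ hs).trans (le_abs_self C)) fun _ => abs_nonneg C
  rw [intervalIntegral.integral_of_le t.coe_nonneg, ofReal_integral_eq_lintegral_ofReal
    (.of_bound hmeas.aestronglyMeasurable |C| (ae_of_all _ hbound))
    (ae_of_all _ fun s => Set.indicator_nonneg h0 _), timeIntegral, hset,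
    ← setLIntegral_indicator (measurableSet_lt ENNReal.measurable_ofReal measurable_const),
    Measure.restrict_congr_set Ico_ae_eq_Ioc]
  refine lintegral_congr fun s => ?_
  by_cases hs : ENNReal.ofReal s < T
  · rw [Set.indicator_of_mem (by exact hs), Set.indicator_of_mem (by exact hs)]
  · rw [Set.indicator_of_notMem (by exact hs), Set.indicator_of_notMem (by exact hs),
      ENNReal.ofReal_zero]

lemma tendsto_timeIntegral_min_natCast (T : ℝ≥0∞) (f : ℝ≥0 → ℝ≥0∞) :
    Tendsto (fun n : ℕ => timeIntegral (min T (n : ℝ≥0)) f) atTop (𝓝 (timeIntegral T f)) := by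
  simp only [ENNReal.coe_natCast]
  have hmono : Monotone fun n : ℕ => {t : ℝ | 0 ≤ t ∧ ENNReal.ofReal t < min T n} :=
    fun m n hmn t ht => ⟨ht.1, ht.2.trans_le (min_le_min_left T (by exact_mod_cast hmn))⟩
  have hunion : ⋃ n : ℕ, {t : ℝ | 0 ≤ t ∧ ENNReal.ofReal t < min T n} =
      {t : ℝ | 0 ≤ t ∧ ENNReal.ofReal t < T} := by
    ext t
    simp only [Set.mem_iUnion, Set.mem_ofPred_eq, exists_and_left, lt_min_iff, and_congr_right_iff,
      and_iff_left_iff_imp]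
    exact fun _ _ => ENNReal.exists_nat_gt ENNReal.ofReal_ne_top
  rw [timeIntegral, ← hunion, setLIntegral_iUnion_of_directed _ hmono.directed_le]
  exact tendsto_atTop_iSup fun m n hmn => lintegral_mono_set (hmono hmn)

end TimeIntegrals

section Dynkin

/-! ### Dynkin's formula -/

variable {Ω : Type*} {X : ℝ≥0 → Ω → Option ℕ} {S : Finset ℕ} {g : ℕ → ℝ}

/-- The rate `g` on `S`, set to `0` on the other points of `E ∪ {∂}` so as to be bounded. -/
def liveRate (S : Finset ℕ) (g : ℕ → ℝ) : Option ℕ → ℝ :=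
  (some '' (S : Set ℕ)).indicator fun o => o.elim 0 g

lemma liveRate_some {x : ℕ} (hx : x ∈ S) : liveRate S g (some x) = g x :=
  Set.indicator_of_mem (Set.mem_image_of_mem some hx) _

lemma liveRate_nonneg (hg : ∀ x ∈ S, 0 ≤ g x) (o : Option ℕ) : 0 ≤ liveRate S g o := by
  refine Set.indicator_nonneg (fun o ho => ?_) o
  obtain ⟨x, hx, rfl⟩ := ho
  exact hg x hx

lemma exists_abs_indicator_image_some_le (S : Finset ℕ) (f : Option ℕ → ℝ) :
    ∃ K, ∀ o, |(some '' (S : Set ℕ)).indicator f o| ≤ K := by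
  refine ⟨∑ x ∈ S, |f (some x)|, fun o => ?_⟩
  by_cases ho : o ∈ some '' (S : Set ℕ)
  · obtain ⟨x, hx, rfl⟩ := id ho
    rw [Set.indicator_of_mem ho]
    exact Finset.single_le_sum (f := fun x => |f (some x)|) (fun _ _ => abs_nonneg _) hx
  · rw [Set.indicator_of_notMem ho, abs_zero]
    exact Finset.sum_nonneg fun _ _ => abs_nonneg _

lemma exists_abs_le_of_eq_none {v : Option ℕ → ℝ} {N : ℕ}
    (hv : ∀ l, N ≤ l → v (some l) = v none) : ∃ C, ∀ o, |v o| ≤ C := by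
  refine ⟨|v none| + ∑ l ∈ Finset.range N, |v (some l)|, fun o => ?_⟩
  have hsum : 0 ≤ ∑ l ∈ Finset.range N, |v (some l)| := Finset.sum_nonneg fun _ _ => abs_nonneg _
  rcases o with _ | k
  · exact le_add_of_nonneg_right hsum
  · rcases lt_or_ge k N with hk | hk
    · exact (Finset.single_le_sum (f := fun l => |v (some l)|) (fun _ _ => abs_nonneg _)
        (Finset.mem_range.2 hk)).trans (le_add_of_nonneg_left (abs_nonneg _))
    · rw [hv k hk]
      exact le_add_of_nonneg_right hsum

/-- The value of `v` at the exit time from `S` capped at `t`, discounted at rate `g`. -/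
def discountedExitValue (X : ℝ≥0 → Ω → Option ℕ) (S : Finset ℕ) (g : ℕ → ℝ) (v : Option ℕ → ℝ)
    (t : ℝ≥0) (w : Ω) : ℝ :=
  pathDiscount (liveRate S g) (fun s => X s w) (cappedExitTime X S t w) *
    v (X (cappedExitTime X S t w) w)

/-- The integral of `φ` along the path up to the exit time from `S` capped at `t`, discounted at
rate `g`. -/
def discountedOccupation (X : ℝ≥0 → Ω → Option ℕ) (S : Finset ℕ) (g : ℕ → ℝ) (φ : Option ℕ → ℝ)
    (t : ℝ≥0) (w : Ω) : ℝ :=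
  ∫ s in (0 : ℝ)..t, {s : ℝ≥0 | (s : ℝ≥0∞) < exitTime X S w}.indicator
    (fun s => pathDiscount (liveRate S g) (fun s => X s w) s * φ (X s w)) s.toNNReal

lemma tendsto_sum_skeletonIncrement_exit {w : Ω} (hx : RightConst fun t => X t w)
    (v : Option ℕ → ℝ) (t : ℝ≥0) :
    Tendsto (fun h : ℝ≥0 => ∑ k ∈ Finset.range ⌈t / h⌉₊,
        skeletonIncrement (some '' (S : Set ℕ)) (liveRate S g) v h (fun k => X (k * h) w) k)
      (𝓝[>] 0) (𝓝 (discountedExitValue X S g v t w - v (X 0 w))) := by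
  obtain ⟨R, hR⟩ := exists_abs_indicator_image_some_le S fun o => o.elim 0 g
  exact tendsto_sum_skeletonIncrement hx hR v (cappedExitTime_le X S t w)
    (fun s hs => apply_mem_of_lt_cappedExitTime hx hs) (cappedExitTime_eq_or_notMem hx S t)

lemma tendsto_sum_discountedOccupation {w : Ω} (hx : RightConst fun t => X t w)
    (hg : ∀ x ∈ S, 0 ≤ g x) {c : ℝ≥0 → Option ℕ → ℝ} {φ : Option ℕ → ℝ} {C : ℝ}
    (hc : ∀ o ∈ some '' (S : Set ℕ), Tendsto (fun h => c h o) (𝓝[>] 0) (𝓝 (φ o)))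
    (hC : ∀ᶠ h in 𝓝[>] 0, ∀ o, |(some '' (S : Set ℕ)).indicator (c h) o| ≤ C) (t : ℝ≥0) :
    Tendsto (fun h : ℝ≥0 => h * ∑ k ∈ Finset.range ⌈t / h⌉₊,
        skeletonDiscount (some '' (S : Set ℕ)) (liveRate S g) h (fun k => X (k * h) w) k *
          (some '' (S : Set ℕ)).indicator (c h) (X (k * h) w)) (𝓝[>] 0)
      (𝓝 (discountedOccupation X S g φ t w)) := by
  obtain ⟨R, hR⟩ := exists_abs_indicator_image_some_le S fun o => o.elim 0 g
  simp only [discountedOccupation, lt_exitTime_iff hx S]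
  exact tendsto_sum_skeletonDiscount_mul_indicator hx (liveRate_nonneg hg) hR hc hC t

lemma abs_mul_sum_skeletonDiscount_le (A : Set (Option ℕ)) {r f : Option ℕ → ℝ}
    (hr : ∀ o, 0 ≤ r o) {C : ℝ} (hC : ∀ o, |f o| ≤ C) {h : ℝ≥0} (hh : 0 < h) (hh1 : h ≤ 1)
    (t : ℝ≥0) (y : ℕ → Option ℕ) :
    |h * ∑ k ∈ Finset.range ⌈t / h⌉₊, skeletonDiscount A r h y k * f (y k)| ≤ (t + 1) * C := by
  have hsum : |∑ k ∈ Finset.range ⌈t / h⌉₊, skeletonDiscount A r h y k * f (y k)| ≤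
      ⌈t / h⌉₊ * C := by
    refine (Finset.abs_sum_le_sum_abs _ _).trans ((Finset.sum_le_card_nsmul _ _ C fun k _ =>
      abs_skeletonDiscount_mul_le A hr h y k (hC (y k))).trans_eq ?_)
    rw [Finset.card_range, nsmul_eq_mul]
  have hC0 : 0 ≤ C := (abs_nonneg _).trans (hC none)
  have hceil : (⌈t / h⌉₊ : ℝ) * h ≤ t + 1 := by
    exact_mod_cast (ceil_div_mul_le t hh).trans (add_le_add_right hh1 t)
  rw [abs_mul, abs_of_nonneg h.coe_nonneg]
  calc (h : ℝ) * |∑ k ∈ Finset.range ⌈t / h⌉₊, skeletonDiscount A r h y k * f (y k)|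
      ≤ h * (⌈t / h⌉₊ * C) := by gcongr
    _ = ⌈t / h⌉₊ * h * C := by ring
    _ ≤ (t + 1) * C := by gcongr

variable [MeasurableSpace Ω] {Q : ℕ → ℕ → ℝ} {P : ℕ → Measure Ω}

lemma IsKilledChain.aestronglyMeasurable_discountedExitValue (hX : IsKilledChain Q X P) (i : ℕ)
    (hg : ∀ x ∈ S, 0 ≤ g x) {v : Option ℕ → ℝ} {C : ℝ} (hC : ∀ o, |v o| ≤ C) (t : ℝ≥0) :
    AEStronglyMeasurable (discountedExitValue X S g v t) (P i) := by
  have hsub : AEStronglyMeasurable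
      (fun w => discountedExitValue X S g v t w - v (X 0 w)) (P i) :=
    aestronglyMeasurable_of_tendsto_ae (𝓝[>] (0 : ℝ≥0))
      (fun h => (integrable_finsetSum (Finset.range ⌈t / h⌉₊) fun k _ =>
        hX.integrable_skeletonIncrement i _ (liveRate_nonneg hg) hC h k).aestronglyMeasurable)
      (ae_of_all _ fun w => tendsto_sum_skeletonIncrement_exit (hX.rightConst w) v t)
  exact (hsub.add (hX.measurable_comp_apply v 0).aestronglyMeasurable).congr
    (ae_of_all _ fun w => sub_add_cancel _ _)

lemma IsKilledChain.integrable_discountedOccupation (hX : IsKilledChain Q X P) (i : ℕ)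
    (hg : ∀ x ∈ S, 0 ≤ g x) (φ : Option ℕ → ℝ) (t : ℝ≥0) :
    Integrable (discountedOccupation X S g φ t) (P i) := by
  have : IsProbabilityMeasure (P i) := hX.prob i
  obtain ⟨K, hK⟩ := exists_abs_indicator_image_some_le S φ
  have hlim := fun w => tendsto_sum_discountedOccupation (hX.rightConst w) hg
    (c := fun _ => φ) (fun _ _ => tendsto_const_nhds) (Eventually.of_forall fun _ => hK) t
  have hpos : ∀ᶠ h : ℝ≥0 in 𝓝[>] 0, 0 < h := self_mem_nhdsWithin
  have hone : ∀ᶠ h : ℝ≥0 in 𝓝[>] 0, h ≤ 1 := nhdsWithin_le_nhds (Iic_mem_nhds zero_lt_one)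
  refine .of_bound (aestronglyMeasurable_of_tendsto_ae (𝓝[>] (0 : ℝ≥0)) (fun h => ?_)
    (ae_of_all _ hlim)) ((t + 1) * K) (ae_of_all _ fun w => le_of_tendsto (hlim w).abs ?_)
  · exact ((integrable_finsetSum _ fun k _ => hX.integrable_skeletonDiscount_mul i _
      (liveRate_nonneg hg) hK h k).const_mul _).aestronglyMeasurable
  · filter_upwards [hpos, hone] with h hh hh1
    exact abs_mul_sum_skeletonDiscount_le _ (liveRate_nonneg hg) hK hh hh1 t fun k => X (k * h) w

lemma IsKilledChain.tendsto_integral_sum_skeletonIncrement (hX : IsKilledChain Q X P) (i : ℕ)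
    (hg : ∀ x ∈ S, 0 ≤ g x) {v : Option ℕ → ℝ} {C : ℝ} (hC : ∀ o, |v o| ≤ C) (t : ℝ≥0) :
    Tendsto (fun h : ℝ≥0 => ∫ w, ∑ k ∈ Finset.range ⌈t / h⌉₊, skeletonIncrement
        (some '' (S : Set ℕ)) (liveRate S g) v h (fun k => X (k * h) w) k ∂P i) (𝓝[>] 0)
      (𝓝 (∫ w, discountedExitValue X S g v t w - v (some i) ∂P i)) := by
  have : IsProbabilityMeasure (P i) := hX.prob i
  refine tendsto_integral_filter_of_dominated_convergence (fun _ => 2 * C)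
    (Eventually.of_forall fun h => ?_) (Eventually.of_forall fun h => ae_of_all _ fun w => ?_)
    (integrable_const _) ?_
  · exact (integrable_finsetSum _ fun k _ =>
      hX.integrable_skeletonIncrement i _ (liveRate_nonneg hg) hC h k).aestronglyMeasurable
  · exact abs_sum_skeletonIncrement_le _ (liveRate_nonneg hg) hC h _ _
  · filter_upwards [hX.ae_start i] with w hw
    simpa only [hw] using tendsto_sum_skeletonIncrement_exit (hX.rightConst w) v t

lemma IsKilledChain.tendsto_integral_sum_killedDiffQuot (hX : IsKilledChain Q X P) (i : ℕ)
    (hg : ∀ x ∈ S, 0 ≤ g x) {v φ : Option ℕ → ℝ} {N : ℕ}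
    (hv : ∀ l, N ≤ l → v (some l) = v none) (hφ : ∀ x ∈ S, generator Q g N v x = φ (some x))
    (t : ℝ≥0) :
    Tendsto (fun h : ℝ≥0 => ∫ w, h * ∑ k ∈ Finset.range ⌈t / h⌉₊,
        skeletonDiscount (some '' (S : Set ℕ)) (liveRate S g) h (fun k => X (k * h) w) k *
          (some '' (S : Set ℕ)).indicator (killedDiffQuot X P N (liveRate S g) v h)
            (X (k * h) w) ∂P i) (𝓝[>] 0)
      (𝓝 (∫ w, discountedOccupation X S g φ t w ∂P i)) := by
  have : IsProbabilityMeasure (P i) := hX.prob i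
  obtain ⟨K, hK⟩ := hX.eventually_abs_killedDiffQuot_le hv fun x hx => liveRate_some (g := g) hx
  have hpos : ∀ᶠ h : ℝ≥0 in 𝓝[>] 0, 0 < h := self_mem_nhdsWithin
  have hone : ∀ᶠ h : ℝ≥0 in 𝓝[>] 0, h ≤ 1 := nhdsWithin_le_nhds (Iic_mem_nhds zero_lt_one)
  have hlim : ∀ o ∈ some '' (S : Set ℕ), Tendsto
      (fun h => killedDiffQuot X P N (liveRate S g) v h o) (𝓝[>] 0) (𝓝 (φ o)) := by
    rintro _ ⟨x, hx, rfl⟩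
    exact hφ x hx ▸ hX.tendsto_killedDiffQuot hv (liveRate_some hx)
  refine tendsto_integral_filter_of_dominated_convergence (fun _ => (t + 1) * K) ?_ ?_
    (integrable_const _)
    (ae_of_all _ fun w => tendsto_sum_discountedOccupation (hX.rightConst w) hg hlim hK t)
  · filter_upwards [hK] with h hKh
    exact ((integrable_finsetSum _ fun k _ => hX.integrable_skeletonDiscount_mul i _
      (liveRate_nonneg hg) hKh h k).const_mul _).aestronglyMeasurable
  · filter_upwards [hK, hpos, hone] with h hKh hh hh1
    exact ae_of_all _ fun w => abs_mul_sum_skeletonDiscount_le _ (liveRate_nonneg hg) hKh hh hh1 t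
      fun k => X (k * h) w

lemma IsKilledChain.integral_discountedExitValue_sub (hX : IsKilledChain Q X P) (i : ℕ)
    (hg : ∀ x ∈ S, 0 ≤ g x) {v φ : Option ℕ → ℝ} {N : ℕ}
    (hv : ∀ l, N ≤ l → v (some l) = v none) (hφ : ∀ x ∈ S, generator Q g N v x = φ (some x))
    (t : ℝ≥0) :
    ∫ w, discountedExitValue X S g v t w - v (some i) ∂P i =
      ∫ w, discountedOccupation X S g φ t w ∂P i := by
  obtain ⟨C, hC⟩ := exists_abs_le_of_eq_none hv
  obtain ⟨K, hK⟩ := hX.eventually_abs_killedDiffQuot_le hv fun x hx => liveRate_some (g := g) hx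
  have hpos : ∀ᶠ h : ℝ≥0 in 𝓝[>] 0, h ≠ 0 := eventually_mem_nhdsWithin.mono fun h hh => ne_of_gt hh
  refine tendsto_nhds_unique (hX.tendsto_integral_sum_skeletonIncrement i hg hC t)
    ((hX.tendsto_integral_sum_killedDiffQuot i hg hv hφ t).congr' ?_)
  filter_upwards [hK, hpos] with h hKh hh
  exact (hX.integral_sum_skeletonIncrement i _ (liveRate_nonneg hg) hC hv hh hKh _).symm

end Dynkin

section ExitProblems

/-! ### Dirichlet and Poisson problems -/

lemma pathDiscount_pos {α : Type*} (r : α → ℝ) (x : ℝ≥0 → α) (t : ℝ≥0) :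
    0 < pathDiscount r x t :=
  Real.exp_pos _

lemma pathDiscount_le_one {α : Type*} {r : α → ℝ} (hr : ∀ o, 0 ≤ r o) (x : ℝ≥0 → α) (t : ℝ≥0) :
    pathDiscount r x t ≤ 1 :=
  Real.exp_le_one_iff.2 <| neg_nonpos.2 <|
    intervalIntegral.integral_nonneg t.coe_nonneg fun _ _ => hr _

lemma RightConst.measurable_pathDiscount {α : Type*} {x : ℝ≥0 → α} (hx : RightConst x)
    {r : α → ℝ} {R : ℝ} (hR : ∀ o, |r o| ≤ R) : Measurable (pathDiscount r x) := by
  have hint : ∀ a b : ℝ, IntervalIntegrable (fun s : ℝ => r (x s.toNNReal)) volume a b := fun a b =>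
    (intervalIntegrable_const (c := R)).mono_fun
      (((hx.comp r).measurable.comp measurable_real_toNNReal).aestronglyMeasurable)
      (ae_of_all _ fun s => (hR _).trans (le_abs_self R))
  exact (Real.continuous_exp.comp
    (intervalIntegral.continuous_primitive hint 0).neg).measurable.comp measurable_coe_nnreal_real

variable {Ω : Type*} {X : ℝ≥0 → Ω → Option ℕ} {S : Finset ℕ} {g : ℕ → ℝ} {w : Ω}

lemma discount_eq_ofReal_pathDiscount (hx : RightConst fun t => X t w) (hg : ∀ x ∈ S, 0 ≤ g x)
    {t : ℝ≥0} (ht : (t : ℝ≥0∞) ≤ exitTime X S w) :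
    discount g X t w = ENNReal.ofReal (pathDiscount (liveRate S g) (fun s => X s w) t) := by
  obtain ⟨R, hR⟩ := exists_abs_indicator_image_some_le S fun o => o.elim 0 g
  have hrate : timeIntegral t (fun s => ENNReal.ofReal ((X s w).elim 0 g)) =
      timeIntegral t fun s => ENNReal.ofReal (liveRate S g (X s w)) :=
    timeIntegral_congr fun s hs => congrArg ENNReal.ofReal
      (Set.indicator_of_mem (f := fun o => o.elim 0 g)
        ((lt_exitTime_iff hx S s).1 (hs.trans_le ht) s le_rfl)).symm
  have hint := ofReal_intervalIntegral_indicator ⊤ t (hx.comp (liveRate S g)).measurable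
    (fun s _ => liveRate_nonneg hg _) fun s _ => (le_abs_self _).trans (hR _)
  simp only [ENNReal.coe_lt_top, Set.ofPred_true, Set.indicator_univ, min_eq_right le_top] at hint
  have hnonneg : 0 ≤ ∫ s in (0 : ℝ)..t, liveRate S g (X s.toNNReal w) :=
    intervalIntegral.integral_nonneg t.coe_nonneg fun _ _ => liveRate_nonneg hg _
  change EReal.exp (-_) = _
  rw [hrate, ← hint, EReal.coe_ennreal_ofReal, max_eq_left hnonneg, ← EReal.coe_neg,
    EReal.exp_coe, pathDiscount]

lemma ofReal_discountedOccupation (hx : RightConst fun t => X t w) (hg : ∀ x ∈ S, 0 ≤ g x)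
    {φ : Option ℕ → ℝ} (hφ : ∀ x ∈ S, 0 ≤ φ (some x)) (t : ℝ≥0) :
    ENNReal.ofReal (discountedOccupation X S g φ t w) =
      timeIntegral (min (exitTime X S w) t) fun s =>
        ENNReal.ofReal (pathDiscount (liveRate S g) (fun s => X s w) s * φ (X s w)) := by
  obtain ⟨R, hR⟩ := exists_abs_indicator_image_some_le S fun o => o.elim 0 g
  obtain ⟨K, hK⟩ := exists_abs_indicator_image_some_le S φ
  refine ofReal_intervalIntegral_indicator _ t
    ((hx.measurable_pathDiscount hR).mul (hx.comp φ).measurable) (fun s hs => ?_) (C := K)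
    fun s hs => ?_
  all_goals have hs : X s w ∈ some '' (S : Set ℕ) := (lt_exitTime_iff hx S s).1 hs s le_rfl
  · obtain ⟨x, hxS, hxs⟩ := hs
    exact mul_nonneg (pathDiscount_pos _ _ s).le (hxs ▸ hφ x hxS)
  · have hle := hK (X s w)
    rw [Set.indicator_of_mem hs] at hle
    calc pathDiscount (liveRate S g) (fun s => X s w) s * φ (X s w)
        ≤ pathDiscount (liveRate S g) (fun s => X s w) s * K :=
          mul_le_mul_of_nonneg_left ((le_abs_self _).trans hle) (pathDiscount_pos _ _ s).le
      _ ≤ K := mul_le_of_le_one_left ((abs_nonneg _).trans hle)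
          (pathDiscount_le_one (liveRate_nonneg hg) _ s)

lemma discountedOccupation_nonneg (hx : RightConst fun t => X t w) {φ : Option ℕ → ℝ}
    (hφ : ∀ x ∈ S, 0 ≤ φ (some x)) (t : ℝ≥0) : 0 ≤ discountedOccupation X S g φ t w := by
  refine intervalIntegral.integral_nonneg t.coe_nonneg fun s _ =>
    Set.indicator_nonneg (fun s hs => ?_) _
  obtain ⟨x, hxS, hxs⟩ := (lt_exitTime_iff hx S s).1 hs s le_rfl
  exact mul_nonneg (pathDiscount_pos _ _ s).le (hxs ▸ hφ x hxS)

/-- The integral of `φ ≥ 0` along the path up to the exit time from `S`, discounted at rate `g`. -/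
def totalOccupation (X : ℝ≥0 → Ω → Option ℕ) (S : Finset ℕ) (g : ℕ → ℝ) (φ : Option ℕ → ℝ)
    (w : Ω) : ℝ≥0∞ :=
  timeIntegral (exitTime X S w) fun s =>
    ENNReal.ofReal (pathDiscount (liveRate S g) (fun s => X s w) s * φ (X s w))

lemma monotone_ofReal_discountedOccupation (hx : RightConst fun t => X t w)
    (hg : ∀ x ∈ S, 0 ≤ g x) {φ : Option ℕ → ℝ} (hφ : ∀ x ∈ S, 0 ≤ φ (some x)) :
    Monotone fun n : ℕ => ENNReal.ofReal (discountedOccupation X S g φ n w) := by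
  intro m n hmn
  simp only [ofReal_discountedOccupation hx hg hφ]
  exact timeIntegral_mono_left (min_le_min_left _ (by exact_mod_cast hmn)) _

lemma tendsto_ofReal_discountedOccupation (hx : RightConst fun t => X t w)
    (hg : ∀ x ∈ S, 0 ≤ g x) {φ : Option ℕ → ℝ} (hφ : ∀ x ∈ S, 0 ≤ φ (some x)) :
    Tendsto (fun n : ℕ => ENNReal.ofReal (discountedOccupation X S g φ n w)) atTop
      (𝓝 (totalOccupation X S g φ w)) := by
  simp only [ofReal_discountedOccupation hx hg hφ]
  exact tendsto_timeIntegral_min_natCast _ _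

lemma totalOccupation_zero_one (hw : exitTime X S w = ⊤) :
    totalOccupation X S 0 1 w = ⊤ := by
  have hone : ∀ s, pathDiscount (liveRate S 0) (fun s => X s w) s = 1 := fun s => by
    have hzero : ∀ o, liveRate S 0 o = 0 := fun o =>
      Set.indicator_apply_eq_zero.2 fun _ => by cases o <;> rfl
    simp only [pathDiscount, hzero, intervalIntegral.integral_zero, neg_zero, Real.exp_zero]
  simp only [totalOccupation, hone, Pi.one_apply, mul_one, ENNReal.ofReal_one, hw,
    timeIntegral_top_one]

/-- The value of `v` at the exit time from `S`, discounted at rate `g`; a junk value on the event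
that the chain never leaves `S`. -/
def exitValue (X : ℝ≥0 → Ω → Option ℕ) (S : Finset ℕ) (g : ℕ → ℝ) (v : Option ℕ → ℝ) (w : Ω) : ℝ :=
  discountedExitValue X S g v (exitTime X S w).toNNReal w

lemma exitValue_eq {v : Option ℕ → ℝ} {t : ℝ≥0} (ht : exitTime X S w = t) :
    exitValue X S g v w = pathDiscount (liveRate S g) (fun s => X s w) t * v (X t w) := by
  have hcap : cappedExitTime X S t w = t := by
    rw [cappedExitTime, ht, min_self, ENNReal.toNNReal_coe]
  rw [exitValue, discountedExitValue, ht, ENNReal.toNNReal_coe, hcap]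

lemma tendsto_discountedExitValue (v : Option ℕ → ℝ) (hw : exitTime X S w ≠ ⊤) :
    Tendsto (fun n : ℕ => discountedExitValue X S g v n w) atTop (𝓝 (exitValue X S g v w)) := by
  lift exitTime X S w to ℝ≥0 using hw with t ht
  refine tendsto_const_nhds.congr' ?_
  filter_upwards [tendsto_natCast_atTop_atTop.eventually_ge_atTop t] with n hn
  have hcap : cappedExitTime X S n w = t := by
    rw [cappedExitTime, ← ht, min_eq_left (by exact_mod_cast hn), ENNReal.toNNReal_coe]
  rw [exitValue_eq ht.symm, discountedExitValue, hcap]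

lemma abs_discountedExitValue_le (hg : ∀ x ∈ S, 0 ≤ g x) {v : Option ℕ → ℝ} {C : ℝ}
    (hC : ∀ o, |v o| ≤ C) (t : ℝ≥0) (w : Ω) : |discountedExitValue X S g v t w| ≤ C := by
  rw [discountedExitValue, abs_mul, abs_of_pos (pathDiscount_pos _ _ _)]
  exact (mul_le_of_le_one_left (abs_nonneg _)
    (pathDiscount_le_one (liveRate_nonneg hg) _ _)).trans (hC _)

variable [MeasurableSpace Ω] {Q : ℕ → ℕ → ℝ} {P : ℕ → Measure Ω}

lemma IsKilledChain.integrable_exitValue (hX : IsKilledChain Q X P) {i : ℕ}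
    (hg : ∀ x ∈ S, 0 ≤ g x) {v : Option ℕ → ℝ} {C : ℝ} (hC : ∀ o, |v o| ≤ C)
    (hfin : ∀ᵐ w ∂P i, exitTime X S w ≠ ⊤) : Integrable (exitValue X S g v) (P i) := by
  have : IsProbabilityMeasure (P i) := hX.prob i
  exact .of_bound (aestronglyMeasurable_of_tendsto_ae atTop
    (fun n : ℕ => hX.aestronglyMeasurable_discountedExitValue i hg hC n)
    (hfin.mono fun w hw => tendsto_discountedExitValue v hw)) C
    (ae_of_all _ fun w => abs_discountedExitValue_le hg hC _ w)

lemma IsKilledChain.tendsto_integral_discountedExitValue (hX : IsKilledChain Q X P) {i : ℕ}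
    (hg : ∀ x ∈ S, 0 ≤ g x) {v : Option ℕ → ℝ} {C : ℝ} (hC : ∀ o, |v o| ≤ C)
    (hfin : ∀ᵐ w ∂P i, exitTime X S w ≠ ⊤) :
    Tendsto (fun n : ℕ => ∫ w, discountedExitValue X S g v n w ∂P i) atTop
      (𝓝 (∫ w, exitValue X S g v w ∂P i)) := by
  have : IsProbabilityMeasure (P i) := hX.prob i
  exact tendsto_integral_of_dominated_convergence (fun _ => C)
    (fun n => hX.aestronglyMeasurable_discountedExitValue i hg hC n) (integrable_const _)
    (fun n => ae_of_all _ fun w => abs_discountedExitValue_le hg hC _ w)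
    (hfin.mono fun w hw => tendsto_discountedExitValue v hw)

lemma IsKilledChain.integral_discountedOccupation_of_generator_eq_neg (hX : IsKilledChain Q X P)
    (i : ℕ) (hg : ∀ x ∈ S, 0 ≤ g x) {v φ : Option ℕ → ℝ} {N : ℕ}
    (hv : ∀ l, N ≤ l → v (some l) = v none) (hφ : ∀ x ∈ S, generator Q g N v x = -φ (some x))
    (t : ℝ≥0) :
    ∫ w, discountedOccupation X S g φ t w ∂P i =
      v (some i) - ∫ w, discountedExitValue X S g v t w ∂P i := by
  have : IsProbabilityMeasure (P i) := hX.prob i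
  obtain ⟨C, hC⟩ := exists_abs_le_of_eq_none hv
  have hint : Integrable (discountedExitValue X S g v t) (P i) :=
    .of_bound (hX.aestronglyMeasurable_discountedExitValue i hg hC t) C
      (ae_of_all _ fun w => abs_discountedExitValue_le hg hC t w)
  have hneg : ∀ w, discountedOccupation X S g (-φ) t w = -discountedOccupation X S g φ t w := by
    intro w
    simp only [discountedOccupation, Pi.neg_apply, mul_neg, ← intervalIntegral.integral_neg]
    congr 1 with s
    exact congrFun (Set.indicator_neg' _ _) _
  have hdynkin := hX.integral_discountedExitValue_sub i hg hv (φ := -φ) hφ t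
  simp only [hneg] at hdynkin
  rw [integral_neg, integral_sub hint (integrable_const _), integral_const, probReal_univ,
    one_smul] at hdynkin
  linarith

lemma IsKilledChain.integral_exitValue (hX : IsKilledChain Q X P) {i : ℕ}
    (hg : ∀ x ∈ S, 0 ≤ g x) {v : Option ℕ → ℝ} {N : ℕ}
    (hv : ∀ l, N ≤ l → v (some l) = v none) (h0 : ∀ x ∈ S, generator Q g N v x = 0)
    (hfin : ∀ᵐ w ∂P i, exitTime X S w ≠ ⊤) :
    ∫ w, exitValue X S g v w ∂P i = v (some i) := by
  obtain ⟨C, hC⟩ := exists_abs_le_of_eq_none hv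
  refine tendsto_nhds_unique (hX.tendsto_integral_discountedExitValue hg hC hfin)
    (tendsto_const_nhds.congr fun n => ?_)
  have hzero := hX.integral_discountedOccupation_of_generator_eq_neg i hg hv (φ := 0)
    (fun x hx => (h0 x hx).trans neg_zero.symm) n
  simp only [discountedOccupation, Pi.zero_apply, mul_zero, Set.indicator_zero,
    intervalIntegral.integral_zero, integral_zero] at hzero
  linarith

lemma IsKilledChain.integral_exitValue_le (hX : IsKilledChain Q X P) {i : ℕ}
    (hg : ∀ x ∈ S, 0 ≤ g x) {v φ : Option ℕ → ℝ} {N : ℕ}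
    (hv : ∀ l, N ≤ l → v (some l) = v none) (hφ : ∀ x ∈ S, generator Q g N v x = -φ (some x))
    (hφ0 : ∀ x ∈ S, 0 ≤ φ (some x)) (hfin : ∀ᵐ w ∂P i, exitTime X S w ≠ ⊤) :
    ∫ w, exitValue X S g v w ∂P i ≤ v (some i) := by
  obtain ⟨C, hC⟩ := exists_abs_le_of_eq_none hv
  refine le_of_tendsto' (hX.tendsto_integral_discountedExitValue hg hC hfin) fun n =>
    sub_nonneg.1 ?_
  rw [← hX.integral_discountedOccupation_of_generator_eq_neg i hg hv hφ]
  exact integral_nonneg fun w => discountedOccupation_nonneg (hX.rightConst w) hφ0 n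

lemma IsKilledChain.aemeasurable_totalOccupation (hX : IsKilledChain Q X P) (i : ℕ)
    (hg : ∀ x ∈ S, 0 ≤ g x) {φ : Option ℕ → ℝ} (hφ : ∀ x ∈ S, 0 ≤ φ (some x)) :
    AEMeasurable (totalOccupation X S g φ) (P i) :=
  aemeasurable_of_tendsto_metrizable_ae atTop
    (fun n : ℕ => (hX.integrable_discountedOccupation i hg φ n).aemeasurable.ennreal_ofReal)
    (ae_of_all _ fun w => tendsto_ofReal_discountedOccupation (hX.rightConst w) hg hφ)

lemma IsKilledChain.tendsto_ofReal_sub_integral_discountedExitValue (hX : IsKilledChain Q X P)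
    (i : ℕ) (hg : ∀ x ∈ S, 0 ≤ g x) {v φ : Option ℕ → ℝ} {N : ℕ}
    (hv : ∀ l, N ≤ l → v (some l) = v none) (hφ : ∀ x ∈ S, generator Q g N v x = -φ (some x))
    (hφ0 : ∀ x ∈ S, 0 ≤ φ (some x)) :
    Tendsto (fun n : ℕ => ENNReal.ofReal (v (some i) - ∫ w, discountedExitValue X S g v n w ∂P i))
      atTop (𝓝 (∫⁻ w, totalOccupation X S g φ w ∂P i)) := by
  refine (lintegral_tendsto_of_tendsto_of_monotone
    (fun n : ℕ => (hX.integrable_discountedOccupation i hg φ n).aemeasurable.ennreal_ofReal)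
    (ae_of_all _ fun w => monotone_ofReal_discountedOccupation (hX.rightConst w) hg hφ0)
    (ae_of_all _ fun w => tendsto_ofReal_discountedOccupation (hX.rightConst w) hg hφ0)).congr
    fun n => ?_
  rw [← hX.integral_discountedOccupation_of_generator_eq_neg i hg hv hφ,
    ofReal_integral_eq_lintegral_ofReal (hX.integrable_discountedOccupation i hg φ n)
      (ae_of_all _ fun w => discountedOccupation_nonneg (hX.rightConst w) hφ0 n)]

lemma IsKilledChain.lintegral_totalOccupation (hX : IsKilledChain Q X P) {i : ℕ}
    (hg : ∀ x ∈ S, 0 ≤ g x) {v φ : Option ℕ → ℝ} {N : ℕ}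
    (hv : ∀ l, N ≤ l → v (some l) = v none) (hφ : ∀ x ∈ S, generator Q g N v x = -φ (some x))
    (hφ0 : ∀ x ∈ S, 0 ≤ φ (some x)) (hfin : ∀ᵐ w ∂P i, exitTime X S w ≠ ⊤) :
    ∫⁻ w, totalOccupation X S g φ w ∂P i =
      ENNReal.ofReal (v (some i) - ∫ w, exitValue X S g v w ∂P i) := by
  obtain ⟨C, hC⟩ := exists_abs_le_of_eq_none hv
  exact tendsto_nhds_unique
    (hX.tendsto_ofReal_sub_integral_discountedExitValue i hg hv hφ hφ0)
    ((ENNReal.continuous_ofReal.tendsto _).comp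
      ((hX.tendsto_integral_discountedExitValue hg hC hfin).const_sub _))

lemma IsKilledChain.ae_exitTime_ne_top (hX : IsKilledChain Q X P) (i : ℕ) {v : Option ℕ → ℝ}
    {N : ℕ} (hv : ∀ l, N ≤ l → v (some l) = v none) (h1 : ∀ x ∈ S, generator Q 0 N v x = -1) :
    ∀ᵐ w ∂P i, exitTime X S w ≠ ⊤ := by
  have : IsProbabilityMeasure (P i) := hX.prob i
  obtain ⟨C, hC⟩ := exists_abs_le_of_eq_none hv
  have hg : ∀ x ∈ S, (0 : ℝ) ≤ (0 : ℕ → ℝ) x := fun _ _ => le_rfl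
  have hφ0 : ∀ x ∈ S, (0 : ℝ) ≤ (1 : Option ℕ → ℝ) (some x) := fun _ _ => zero_le_one
  have hbound : ∀ n : ℕ, v (some i) - ∫ w, discountedExitValue X S 0 v n w ∂P i ≤ 2 * C := by
    intro n
    have hmean := norm_integral_le_of_norm_le_const (μ := P i)
      (f := discountedExitValue X S 0 v n) (C := C)
      (ae_of_all _ fun w => abs_discountedExitValue_le hg hC n w)
    rw [probReal_univ, mul_one, Real.norm_eq_abs] at hmean
    linarith [(abs_le.1 hmean).1, (abs_le.1 (hC (some i))).2]
  have hlt := (le_of_tendsto' (hX.tendsto_ofReal_sub_integral_discountedExitValue i hg hv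
    (φ := 1) h1 hφ0) fun n => ENNReal.ofReal_le_ofReal (hbound n)).trans_lt ENNReal.ofReal_lt_top
  filter_upwards [ae_lt_top' (hX.aemeasurable_totalOccupation i hg hφ0) hlt.ne] with w hw htop
  exact hw.ne (totalOccupation_zero_one htop)

end ExitProblems

section Targets

variable {Ω : Type*} {X : ℝ≥0 → Ω → Option ℕ} {S : Finset ℕ} {g : ℕ → ℝ} {w : Ω}

lemma entryTime_eq_exitTime {F : Set (Option ℕ)} (hF : F ⊆ (some '' (S : Set ℕ))ᶜ) {t : ℝ≥0}
    (ht : exitTime X S w = t) (htF : X t w ∈ F) : entryTime X F w = exitTime X S w :=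
  le_antisymm ((iInf₂_le t htF).trans_eq ht.symm) (biInf_mono fun _ hs => hF hs)

lemma exitValue_eq_indicator_discount (hx : RightConst fun t => X t w) (hg : ∀ x ∈ S, 0 ≤ g x)
    {F G : Set (Option ℕ)} (hFG : Disjoint F G) {v : Option ℕ → ℝ} (hF : ∀ o ∈ F, v o = 1)
    (hG : ∀ o ∈ G, v o = 0) (hw : exitTime X S w ≠ ⊤)
    (hexit : entryTime X (F ∪ G) w = exitTime X S w) :
    ENNReal.ofReal (exitValue X S g v w) =
      {w | entryTime X F w < entryTime X G w}.indicator
        (fun w => discount g X (entryTime X F w) w) w := by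
  obtain ⟨t, ht⟩ := WithTop.ne_top_iff_exists.1 hw
  have htFG := hexit.trans ht.symm
  have hiff := entryTime_lt_entryTime_iff hx hFG htFG
  rw [exitValue_eq ht.symm]
  rcases apply_entryTime_mem hx htFG with hXF | hXG
  · have hFt : entryTime X F w = t := by
      rw [entryTime_union, min_eq_left (hiff.2 hXF).le] at htFG
      exact htFG
    rw [Set.indicator_of_mem (by exact hiff.2 hXF), hFt, hF _ hXF, mul_one,
      discount_eq_ofReal_pathDiscount hx hg ht.le]
  · have hXF : X t w ∉ F := fun hXF => hFG.le_bot ⟨hXF, hXG⟩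
    rw [Set.indicator_of_notMem (by exact hiff.not.2 hXF), hG _ hXG, mul_zero,
      ENNReal.ofReal_zero]

variable [MeasurableSpace Ω] {Q : ℕ → ℕ → ℝ} {P : ℕ → Measure Ω}

lemma IsKilledChain.nullMeasurableSet_entryTime_lt (hX : IsKilledChain Q X P) {i : ℕ}
    {F G : Set (Option ℕ)} (hFG : Disjoint F G)
    (hfin : ∀ᵐ w ∂P i, exitTime X S w ≠ ⊤)
    (hexit : ∀ᵐ w ∂P i, entryTime X (F ∪ G) w = exitTime X S w) :
    NullMeasurableSet {w | entryTime X F w < entryTime X G w} (P i) := by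
  have hbound : ∀ o, |F.indicator (1 : Option ℕ → ℝ) o| ≤ 1 :=
    abs_indicator_le F fun _ => (abs_one).le
  have hmeas := (hX.integrable_exitValue (g := 0) (fun _ _ => le_rfl) hbound hfin).aemeasurable
  refine (nullMeasurableSet_lt aemeasurable_const hmeas : NullMeasurableSet
    {w | 0 < exitValue X S 0 (F.indicator 1) w} (P i)).congr ?_
  filter_upwards [hfin, hexit] with w hw hwexit
  obtain ⟨t, ht⟩ := WithTop.ne_top_iff_exists.1 hw
  have hiff := entryTime_lt_entryTime_iff (hX.rightConst w) hFG (hwexit.trans ht.symm)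
  refine propext (Iff.trans ?_ hiff.symm)
  change 0 < exitValue X S 0 (F.indicator 1) w ↔ _
  rw [exitValue_eq ht.symm, mul_pos_iff_of_pos_left (pathDiscount_pos _ _ t)]
  by_cases hXF : X t w ∈ F
  · simp only [hXF, Set.indicator_of_mem, Pi.one_apply, zero_lt_one]
  · simp only [hXF, Set.indicator_of_notMem, not_false_eq_true, lt_irrefl]

lemma IsKilledChain.setLIntegral_discount (hX : IsKilledChain Q X P) {i : ℕ}
    (hg : ∀ x ∈ S, 0 ≤ g x) {F G : Set (Option ℕ)} (hFG : Disjoint F G) {v : Option ℕ → ℝ}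
    {N : ℕ} (hv : ∀ l, N ≤ l → v (some l) = v none) (h0 : ∀ x ∈ S, generator Q g N v x = 0)
    (hF : ∀ o ∈ F, v o = 1) (hG : ∀ o ∈ G, v o = 0) (hfin : ∀ᵐ w ∂P i, exitTime X S w ≠ ⊤)
    (hexit : ∀ᵐ w ∂P i, entryTime X (F ∪ G) w = exitTime X S w) :
    ((∫⁻ w in {w | entryTime X F w < entryTime X G w},
      discount g X (entryTime X F w) w ∂P i : ℝ≥0∞) : EReal) = v (some i) := by
  obtain ⟨C, hC⟩ := exists_abs_le_of_eq_none hv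
  have hint := hX.integrable_exitValue hg hC hfin
  have hnonneg : 0 ≤ᵐ[P i] exitValue X S g v := by
    filter_upwards [hfin, hexit] with w hw hwexit
    obtain ⟨t, ht⟩ := WithTop.ne_top_iff_exists.1 hw
    rw [exitValue_eq ht.symm]
    refine mul_nonneg (pathDiscount_pos _ _ t).le ?_
    rcases apply_entryTime_mem (hX.rightConst w) (hwexit.trans ht.symm) with hXF | hXG
    · exact (hF _ hXF).symm ▸ zero_le_one
    · exact (hG _ hXG).ge
  rw [← lintegral_indicator₀ (hX.nullMeasurableSet_entryTime_lt hFG hfin hexit)]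
  have hcongr : ∫⁻ w, {w | entryTime X F w < entryTime X G w}.indicator
      (fun w => discount g X (entryTime X F w) w) w ∂P i =
      ∫⁻ w, ENNReal.ofReal (exitValue X S g v w) ∂P i := by
    refine lintegral_congr_ae ?_
    filter_upwards [hfin, hexit] with w hw hwexit
    exact (exitValue_eq_indicator_discount (hX.rightConst w) hg hFG hF hG hw hwexit).symm
  rw [hcongr, ← ofReal_integral_eq_lintegral_ofReal hint hnonneg, EReal.coe_ennreal_ofReal,
    max_eq_left (integral_nonneg_of_ae hnonneg), hX.integral_exitValue hg hv h0 hfin]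

lemma IsKilledChain.lintegral_timeIntegral_discount (hX : IsKilledChain Q X P) {i : ℕ}
    (hg : ∀ x ∈ S, 0 ≤ g x) {F : Set (Option ℕ)} {v : Option ℕ → ℝ} {j N : ℕ}
    (hv : ∀ l, N ≤ l → v (some l) = v none)
    (hvj : ∀ x ∈ S, generator Q g N v x = -if x = j then 1 else 0)
    (hF : ∀ o ∈ F, v o = 0) (hfin : ∀ᵐ w ∂P i, exitTime X S w ≠ ⊤)
    (hexit : ∀ᵐ w ∂P i, entryTime X F w = exitTime X S w) :
    ((∫⁻ w, timeIntegral (entryTime X F w) (fun t => {t : ℝ≥0 | X t w = some j}.indicator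
      (fun t => discount g X (t : ℝ≥0∞) w) t) ∂P i : ℝ≥0∞) : EReal) = v (some i) := by
  have hzero : exitValue X S g v =ᵐ[P i] 0 := by
    filter_upwards [hfin, hexit] with w hw hwexit
    obtain ⟨t, ht⟩ := WithTop.ne_top_iff_exists.1 hw
    rw [exitValue_eq ht.symm, hF _ (apply_entryTime_mem (hX.rightConst w)
      (hwexit.trans ht.symm)), mul_zero, Pi.zero_apply]
  have hcongr : (fun w => timeIntegral (entryTime X F w) fun t =>
      {t : ℝ≥0 | X t w = some j}.indicator (fun t => discount g X (t : ℝ≥0∞) w) t) =ᵐ[P i]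
      totalOccupation X S g (({some j} : Set (Option ℕ)).indicator 1) := by
    filter_upwards [hexit] with w hwexit
    rw [hwexit, totalOccupation]
    refine timeIntegral_congr fun t ht => ?_
    by_cases hXj : X t w = some j
    · rw [Set.indicator_of_mem (by exact hXj), Set.indicator_of_mem (by exact hXj),
        discount_eq_ofReal_pathDiscount (hX.rightConst w) hg ht.le, Pi.one_apply, mul_one]
    · rw [Set.indicator_of_notMem (by exact hXj), Set.indicator_of_notMem (by exact hXj), mul_zero,
        ENNReal.ofReal_zero]
  have hφ0 : ∀ x ∈ S, 0 ≤ ({some j} : Set (Option ℕ)).indicator (1 : Option ℕ → ℝ) (some x) :=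
    fun x _ => Set.indicator_nonneg (fun _ _ => zero_le_one) _
  have hφ : ∀ x ∈ S, generator Q g N v x = -({some j} : Set (Option ℕ)).indicator 1 (some x) := by
    intro x hx
    simp only [hvj x hx, Set.indicator_apply, Set.mem_singleton_iff, Option.some_inj, Pi.one_apply]
  have hle := hX.integral_exitValue_le hg hv hφ hφ0 hfin
  rw [lintegral_congr_ae hcongr, hX.lintegral_totalOccupation hg hv hφ hφ0 hfin,
    EReal.coe_ennreal_ofReal, max_eq_left (sub_nonneg.2 hle), integral_congr_ae hzero]
  simp only [Pi.zero_apply, integral_zero, sub_zero]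

end Targets

section Scale

/-! ### The functions `G` and `W` -/

variable {Q : ℕ → ℕ → ℝ} {f g : ℕ → ℝ} {a i j k m n N : ℕ}

lemma G_self (Q : ℕ → ℕ → ℝ) (f : ℕ → ℝ) (k : ℕ) : G Q f k k = 1 := by
  rw [G, if_pos rfl]

lemma G_of_ne (Q : ℕ → ℕ → ℝ) (f : ℕ → ℝ) (h : n ≠ k) :
    G Q f k n = ∑ l ∈ Finset.Icc (n + 1) k, qTail Q f n l * G Q f k l / Q n (n - 1) := by
  rw [G, if_neg h]
  exact Finset.sum_coe_sort (Finset.Icc (n + 1) k)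
    fun l => qTail Q f n l * G Q f k l / Q n (n - 1)

lemma mul_G_of_ne (hQ : IsRateMatrix Q) (f : ℕ → ℝ) (hn : 1 ≤ n) (h : n ≠ k) :
    Q n (n - 1) * G Q f k n = ∑ l ∈ Finset.Icc (n + 1) k, qTail Q f n l * G Q f k l := by
  rw [G_of_ne Q f h, ← Finset.sum_div, mul_div_cancel₀ _ (hQ.down_pos n hn).ne']

lemma qTail_nonneg (hQ : IsRateMatrix Q) (hf : 0 ≤ f n) (h : n < k) : 0 ≤ qTail Q f n k :=
  add_nonneg (tsum_nonneg fun j => hQ.nonneg _ _ (by omega)) hf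

lemma G_nonneg (hQ : IsRateMatrix Q) (hf : ∀ n, 1 ≤ n → 0 ≤ f n) (hn : 1 ≤ n) :
    0 ≤ G Q f k n := by
  induction hd : k - n using Nat.strong_induction_on generalizing n with
  | _ d ih =>
    rcases eq_or_ne n k with rfl | hne
    · exact (G_self Q f n).symm ▸ zero_le_one
    · rw [G_of_ne Q f hne]
      refine Finset.sum_nonneg fun l hl => ?_
      have hl := Finset.mem_Icc.1 hl
      exact div_nonneg (mul_nonneg (qTail_nonneg hQ (hf n hn) (by omega))
        (ih (k - l) (by omega) (by omega) rfl)) (hQ.down_pos n hn).le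

lemma W_eq_zero (Q : ℕ → ℕ → ℝ) (f : ℕ → ℝ) (h : j ≤ i) : W Q f i j = 0 := by
  rw [W, Finset.Icc_eq_empty (by omega), Finset.sum_empty]

lemma W_pos (hQ : IsRateMatrix Q) (hf : ∀ n, 1 ≤ n → 0 ≤ f n) (h : i < j) : 0 < W Q f i j := by
  have hq := hQ.down_pos j (by omega)
  refine Finset.sum_pos' (fun k hk => ?_) ⟨j, Finset.mem_Icc.2 ⟨h, le_rfl⟩, ?_⟩
  · exact div_nonneg (G_nonneg hQ hf (by have := Finset.mem_Icc.1 hk; omega)) hq.le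
  · exact (G_self Q f j).symm ▸ div_pos zero_lt_one hq

lemma sum_Ioo_mul_W (Q : ℕ → ℕ → ℝ) (f u : ℕ → ℝ) (h : a ≤ i) (N : ℕ) :
    ∑ j ∈ Finset.Ioo a N, u j * W Q f i j = ∑ j ∈ Finset.Ioo i N, u j * W Q f i j := by
  refine (Finset.sum_subset (Finset.Ioo_subset_Ioo_left h) fun j hj hij => ?_).symm
  rw [W_eq_zero Q f (by simp only [Finset.mem_Ioo] at hj hij; omega), mul_zero]

lemma sum_range_mul_W (Q : ℕ → ℕ → ℝ) (f r : ℕ → ℝ) (h : j ≤ N) :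
    ∑ l ∈ Finset.range N, r l * W Q f l j =
      ∑ m ∈ Finset.Icc 1 j, (∑ l ∈ Finset.range m, r l) * (G Q f j m / Q j (j - 1)) := by
  simp only [W, Finset.mul_sum, Finset.sum_mul]
  refine Finset.sum_comm' fun l m => ?_
  simp only [Finset.mem_range, Finset.mem_Icc]
  omega

lemma sum_range_row (hQ : IsRateMatrix Q) (g : ℕ → ℝ) (k m : ℕ) :
    ∑ l ∈ Finset.range m, Q k l = g k - qTail Q (g + killingRate Q) k m := by
  have htail := (hQ.summable k).sum_add_tsum_nat_add m
  simp only [qTail, killingRate, Pi.add_apply, add_comm m, ← htail]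
  ring

lemma sum_range_row_of_lt (hQ : IsRateMatrix Q) (h : m < k) :
    ∑ l ∈ Finset.range m, Q k l = 0 :=
  Finset.sum_eq_zero fun l hl => hQ.skip_free k l (by have := Finset.mem_range.1 hl; omega)

lemma sum_range_row_self (hQ : IsRateMatrix Q) (hk : 1 ≤ k) :
    ∑ l ∈ Finset.range k, Q k l = Q k (k - 1) := by
  obtain ⟨n, rfl⟩ := Nat.exists_eq_add_of_le' hk
  rw [Finset.sum_range_succ, sum_range_row_of_lt hQ n.lt_succ_self, zero_add, Nat.add_sub_cancel]

lemma sum_range_row_mul_W (hQ : IsRateMatrix Q) (g : ℕ → ℝ) (hk : 1 ≤ k) (hkj : k ≤ j)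
    (hjN : j ≤ N) :
    ∑ l ∈ Finset.range N, Q k l * W Q (g + killingRate Q) l j =
      (Q k (k - 1) * G Q (g + killingRate Q) j k -
        ∑ m ∈ Finset.Icc (k + 1) j,
          qTail Q (g + killingRate Q) k m * G Q (g + killingRate Q) j m) / Q j (j - 1) +
        g k * W Q (g + killingRate Q) k j := by
  rw [sum_range_mul_W _ _ _ hjN,
    ← Finset.sum_subset (Finset.Icc_subset_Icc_left hk) fun m hm hkm => by
      rw [sum_range_row_of_lt hQ (by simp only [Finset.mem_Icc] at hm hkm; omega), zero_mul],
    ← Finset.add_sum_Ioc_eq_sum_Icc hkj, ← Finset.Icc_add_one_left_eq_Ioc, sum_range_row_self hQ hk]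
  simp only [sum_range_row hQ g k, W, sub_mul, Finset.sum_sub_distrib, Finset.mul_sum, sub_div,
    Finset.sum_div, mul_div_assoc]
  ring

/-- The column `W(·, j)`, extended by `0` at the cemetery. -/
def scaleColumn (Q : ℕ → ℕ → ℝ) (f : ℕ → ℝ) (j : ℕ) : Option ℕ → ℝ :=
  fun o => o.elim 0 fun i => W Q f i j

lemma generator_scaleColumn (hQ : IsRateMatrix Q) (g : ℕ → ℝ) (hk : 1 ≤ k) (hjN : j ≤ N) :
    generator Q g N (scaleColumn Q (g + killingRate Q) j) k = if k = j then 1 else 0 := by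
  simp only [generator_apply, scaleColumn, Option.elim_some, Option.elim_none, sub_zero]
  rcases lt_or_ge j k with hjk | hkj
  · rw [W_eq_zero _ _ hjk.le, sum_range_mul_W _ _ _ hjN, if_neg hjk.ne', mul_zero, sub_zero]
    refine Finset.sum_eq_zero fun m hm => ?_
    rw [sum_range_row_of_lt hQ ((Finset.mem_Icc.1 hm).2.trans_lt hjk), zero_mul]
  · rw [sum_range_row_mul_W hQ g hk hkj hjN, add_sub_cancel_right]
    rcases eq_or_ne k j with rfl | hne
    · rw [G_self, Finset.Icc_eq_empty (by omega), Finset.sum_empty, if_pos rfl, mul_one, sub_zero,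
        div_self (hQ.down_pos k hk).ne']
    · rw [mul_G_of_ne hQ _ hk hne, sub_self, zero_div, if_neg hne]

lemma generator_one (Q : ℕ → ℕ → ℝ) (g : ℕ → ℝ) (N k : ℕ) : generator Q g N 1 k = -g k := by
  simp only [generator_apply, Pi.one_apply, sub_self, mul_zero, Finset.sum_const_zero, zero_sub,
    mul_one]

/-- The function `W(·, N) / W(a, N)`: the discounted probability of leaving `(a, N)` through `a`. -/
def lowerExit (Q : ℕ → ℕ → ℝ) (g : ℕ → ℝ) (a N : ℕ) : Option ℕ → ℝ :=
  (W Q (g + killingRate Q) a N)⁻¹ • scaleColumn Q (g + killingRate Q) N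

/-- The discounted Green function, with target `j`, of the chain killed on leaving `(a, N)`. -/
def green (Q : ℕ → ℕ → ℝ) (g : ℕ → ℝ) (a N j : ℕ) : Option ℕ → ℝ :=
  W Q (g + killingRate Q) a j • lowerExit Q g a N - scaleColumn Q (g + killingRate Q) j

/-- The discounted probability of leaving `(a, N)` through `[N, ∞) ∪ {∂}`. -/
def upperExit (Q : ℕ → ℕ → ℝ) (g : ℕ → ℝ) (a N : ℕ) : Option ℕ → ℝ :=
  1 - lowerExit Q g a N - ∑ j ∈ Finset.Ioo a N, g j • green Q g a N j

lemma lowerExit_some (Q : ℕ → ℕ → ℝ) (g : ℕ → ℝ) (a N i : ℕ) :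
    lowerExit Q g a N (some i) = W Q (g + killingRate Q) i N / W Q (g + killingRate Q) a N :=
  inv_mul_eq_div _ _

lemma green_some (Q : ℕ → ℕ → ℝ) (g : ℕ → ℝ) (a N j i : ℕ) :
    green Q g a N j (some i) =
      W Q (g + killingRate Q) a j * W Q (g + killingRate Q) i N / W Q (g + killingRate Q) a N -
        W Q (g + killingRate Q) i j := by
  rw [mul_div_assoc, ← lowerExit_some]
  rfl

lemma upperExit_some (Q : ℕ → ℕ → ℝ) (g : ℕ → ℝ) (N : ℕ) (h : a ≤ i) :
    upperExit Q g a N (some i) =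
      1 + ∑ j ∈ Finset.Ioo i N, g j * W Q (g + killingRate Q) i j
        - W Q (g + killingRate Q) i N / W Q (g + killingRate Q) a N *
          (1 + ∑ j ∈ Finset.Ioo a N, g j * W Q (g + killingRate Q) a j) := by
  simp only [upperExit, Pi.sub_apply, Pi.one_apply, Finset.sum_apply, Pi.smul_apply, smul_eq_mul,
    lowerExit_some, green_some, mul_sub, Finset.sum_sub_distrib, sum_Ioo_mul_W Q _ g h]
  rw [mul_add, Finset.mul_sum, Finset.sum_congr rfl fun j _ => show g j * (_ * _ / _) =
    W Q (g + killingRate Q) i N / W Q (g + killingRate Q) a N *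
      (g j * W Q (g + killingRate Q) a j) by ring]
  ring

lemma lowerExit_some_left (hQ : IsRateMatrix Q) (hg : ∀ n, 1 ≤ n → 0 ≤ g n) (h : a < N) :
    lowerExit Q g a N (some a) = 1 := by
  have hf : ∀ n, 1 ≤ n → 0 ≤ (g + killingRate Q) n := fun n hn =>
    add_nonneg (hg n hn) (neg_nonneg.2 (hQ.row_sum_le n))
  rw [lowerExit_some, div_self (W_pos hQ hf h).ne']

lemma green_some_left (hQ : IsRateMatrix Q) (hg : ∀ n, 1 ≤ n → 0 ≤ g n) (h : a < N) (j : ℕ) :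
    green Q g a N j (some a) = 0 := by
  rw [green, Pi.sub_apply, Pi.smul_apply, lowerExit_some_left hQ hg h, smul_eq_mul, mul_one]
  exact sub_self _

lemma upperExit_some_left (hQ : IsRateMatrix Q) (hg : ∀ n, 1 ≤ n → 0 ≤ g n) (h : a < N) :
    upperExit Q g a N (some a) = 0 := by
  simp only [upperExit, Pi.sub_apply, Pi.one_apply, Finset.sum_apply, Pi.smul_apply, smul_zero,
    lowerExit_some_left hQ hg h, green_some_left hQ hg h, sub_self, Finset.sum_const_zero]

lemma scaleColumn_of_notMem (Q : ℕ → ℕ → ℝ) (f : ℕ → ℝ) (h : j ≤ N) {o : Option ℕ}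
    (ho : o ∉ some '' Set.Iio N) : scaleColumn Q f j o = 0 := by
  rcases o with _ | i
  · rfl
  · exact W_eq_zero Q f (h.trans (not_lt.1 fun hi => ho (Set.mem_image_of_mem some hi)))

lemma lowerExit_of_notMem (Q : ℕ → ℕ → ℝ) (g : ℕ → ℝ) (a : ℕ) {o : Option ℕ}
    (ho : o ∉ some '' Set.Iio N) : lowerExit Q g a N o = 0 := by
  rw [lowerExit, Pi.smul_apply, scaleColumn_of_notMem Q _ le_rfl ho, smul_zero]

lemma green_of_notMem (Q : ℕ → ℕ → ℝ) (g : ℕ → ℝ) (a : ℕ) (h : j ≤ N) {o : Option ℕ}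
    (ho : o ∉ some '' Set.Iio N) : green Q g a N j o = 0 := by
  rw [green, Pi.sub_apply, Pi.smul_apply, lowerExit_of_notMem Q g a ho,
    scaleColumn_of_notMem Q _ h ho, smul_zero, sub_zero]

lemma upperExit_of_notMem (Q : ℕ → ℕ → ℝ) (g : ℕ → ℝ) (a : ℕ) {o : Option ℕ}
    (ho : o ∉ some '' Set.Iio N) : upperExit Q g a N o = 1 := by
  rw [upperExit, Pi.sub_apply, Pi.sub_apply, lowerExit_of_notMem Q g a ho, Finset.sum_apply,
    Finset.sum_eq_zero, sub_zero, sub_zero, Pi.one_apply]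
  intro j hj
  rw [Pi.smul_apply, green_of_notMem Q g a (Finset.mem_Ioo.1 hj).2.le ho, smul_zero]

lemma generator_lowerExit (hQ : IsRateMatrix Q) (g : ℕ → ℝ) (hk : k ∈ Finset.Ioo a N) :
    generator Q g N (lowerExit Q g a N) k = 0 := by
  have hk := Finset.mem_Ioo.1 hk
  rw [lowerExit, map_smul, Pi.smul_apply, generator_scaleColumn hQ g (by omega) le_rfl,
    if_neg hk.2.ne, smul_zero]

lemma generator_green (hQ : IsRateMatrix Q) (g : ℕ → ℝ) (hk : k ∈ Finset.Ioo a N) (h : j ≤ N) :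
    generator Q g N (green Q g a N j) k = -if k = j then 1 else 0 := by
  rw [green, map_sub, map_smul, Pi.sub_apply, Pi.smul_apply, generator_lowerExit hQ g hk,
    generator_scaleColumn hQ g (by have := Finset.mem_Ioo.1 hk; omega) h, smul_zero, zero_sub]

lemma generator_upperExit (hQ : IsRateMatrix Q) (g : ℕ → ℝ) (hk : k ∈ Finset.Ioo a N) :
    generator Q g N (upperExit Q g a N) k = 0 := by
  have hgreen : ∑ j ∈ Finset.Ioo a N, g j * generator Q g N (green Q g a N j) k = -g k := by
    rw [Finset.sum_congr rfl fun j hj => by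
      rw [generator_green hQ g hk (Finset.mem_Ioo.1 hj).2.le], Finset.sum_eq_single_of_mem k hk,
      if_pos rfl, mul_neg_one]
    exact fun j _ hjk => by rw [if_neg hjk.symm, neg_zero, mul_zero]
  simp only [upperExit, map_sub, map_sum, map_smul, Pi.sub_apply, Finset.sum_apply, Pi.smul_apply,
    smul_eq_mul, hgreen, generator_one, generator_lowerExit hQ g hk, sub_zero, sub_self]

end Scale

section IntervalExit

/-! ### Exit from an interval -/

variable {Ω : Type*}

lemma min_passTime_killTime (X : ℝ≥0 → Ω → Option ℕ) (N : ℕ) (w : Ω) :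
    min (passTime X N w) (killTime X w) = entryTime X (some '' Set.Iio N)ᶜ w := by
  rw [passTime, killTime, ← entryTime_union]
  congr 1
  ext o
  cases o <;> simp

variable [MeasurableSpace Ω] {Q : ℕ → ℕ → ℝ} {X : ℝ≥0 → Ω → Option ℕ} {P : ℕ → Measure Ω}
  {a i N : ℕ} {ω : ℕ → ℝ}

lemma IsKilledChain.ae_exitTime_Ioo_ne_top (hX : IsKilledChain Q X P) (hQ : IsRateMatrix Q)
    (i a N : ℕ) : ∀ᵐ w ∂P i, exitTime X (Finset.Ioo a N) w ≠ ⊤ := by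
  refine hX.ae_exitTime_ne_top i (N := N)
    (v := -∑ j ∈ Finset.Ioo a N, scaleColumn Q (0 + killingRate Q) j)
    (fun l hl => ?_) fun k hk => ?_
  · simp only [Pi.neg_apply, Finset.sum_apply]
    refine congrArg _ (Finset.sum_congr rfl fun j hj => W_eq_zero Q _ ?_)
    exact (Finset.mem_Ioo.1 hj).2.le.trans hl
  · rw [map_neg, map_sum, Pi.neg_apply, Finset.sum_apply, Finset.sum_congr rfl fun j hj =>
      generator_scaleColumn hQ 0 (by have := Finset.mem_Ioo.1 hk; omega)
        (Finset.mem_Ioo.1 hj).2.le, Finset.sum_ite_eq, if_pos hk]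

lemma IsKilledChain.ae_exitTime_Ioo_apply_notMem (hX : IsKilledChain Q X P) (hQ : IsRateMatrix Q)
    (hai : a ≤ i) (haN : a ≤ N) :
    ∀ᵐ w ∂P i, X (exitTime X (Finset.Ioo a N) w).toNNReal w ∉ some '' Set.Iio a := by
  set v : Option ℕ → ℝ := (some '' Set.Iio a).indicator 1
  have hv_some : ∀ l, a ≤ l → v (some l) = 0 := fun l hl =>
    Set.indicator_of_notMem (by simpa using hl) _
  have hv_none : v none = 0 := Set.indicator_of_notMem (by simp) _
  have hbound : ∀ o, |v o| ≤ 1 := abs_indicator_le _ fun _ => abs_one.le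
  have hfin := hX.ae_exitTime_Ioo_ne_top hQ i a N
  have hg : ∀ x ∈ Finset.Ioo a N, (0 : ℝ) ≤ (0 : ℕ → ℝ) x := fun _ _ => le_rfl
  have hgen : ∀ x ∈ Finset.Ioo a N, generator Q 0 N v x = 0 := fun x hx => by
    rw [generator_apply, hv_none, Pi.zero_apply, zero_mul, sub_zero]
    refine Finset.sum_eq_zero fun l _ => ?_
    rcases lt_or_ge l a with hl | hl
    · rw [hQ.skip_free x l (by have := Finset.mem_Ioo.1 hx; omega), zero_mul]
    · rw [hv_some l hl, sub_zero, mul_zero]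
  have hzero : ∫ w, exitValue X (Finset.Ioo a N) 0 v w ∂P i = 0 :=
    (hX.integral_exitValue hg (fun l hl => (hv_some l (haN.trans hl)).trans hv_none.symm) hgen
      hfin).trans (hv_some i hai)
  have hnonneg : 0 ≤ exitValue X (Finset.Ioo a N) 0 v := fun w =>
    mul_nonneg (pathDiscount_pos _ _ _).le (Set.indicator_nonneg (fun _ _ => zero_le_one) _)
  filter_upwards [hfin, (integral_eq_zero_iff_of_nonneg hnonneg
    (hX.integrable_exitValue hg hbound hfin)).1 hzero] with w hw hw0 hmem
  rw [exitValue_eq (ENNReal.coe_toNNReal hw).symm, Pi.zero_apply] at hw0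
  rcases mul_eq_zero.1 hw0 with h | h
  · exact (pathDiscount_pos _ _ _).ne' h
  · exact one_ne_zero ((Set.indicator_of_mem hmem _).symm.trans h)

lemma IsKilledChain.ae_entryTime_eq_exitTime_Ioo (hX : IsKilledChain Q X P) (hQ : IsRateMatrix Q)
    (hai : a ≤ i) (haN : a ≤ N) :
    ∀ᵐ w ∂P i, entryTime X ({some a} ∪ (some '' Set.Iio N)ᶜ) w =
      exitTime X (Finset.Ioo a N) w := by
  have hsub : {some a} ∪ (some '' Set.Iio N)ᶜ ⊆ (some '' (Finset.Ioo a N : Set ℕ))ᶜ := by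
    rintro (_ | k)
    · simp
    · simp only [Set.singleton_union, Set.mem_insert_iff, Option.some.injEq, Set.mem_compl_iff,
        Set.mem_image, exists_eq_right, Set.mem_Iio, SetLike.mem_coe, Finset.mem_Ioo]
      omega
  filter_upwards [hX.ae_exitTime_Ioo_ne_top hQ i a N,
    hX.ae_exitTime_Ioo_apply_notMem hQ hai haN] with w hw hlow
  have ht := (ENNReal.coe_toNNReal hw).symm
  refine entryTime_eq_exitTime hsub ht ?_
  have hout : X _ w ∈ (some '' (Finset.Ioo a N : Set ℕ))ᶜ :=
    apply_entryTime_mem (hX.rightConst w) ht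
  generalize X (exitTime X (Finset.Ioo a N) w).toNNReal w = o at hlow hout ⊢
  rcases o with _ | k
  · simp
  · simp only [Set.singleton_union, Set.mem_insert_iff, Option.some.injEq, Set.mem_compl_iff,
      Set.mem_image, exists_eq_right, Set.mem_Iio, SetLike.mem_coe, Finset.mem_Ioo]
      at hlow hout ⊢
    omega

lemma IsKilledChain.setLIntegral_discount_hitTime_lt (hX : IsKilledChain Q X P)
    (hQ : IsRateMatrix Q) (hω : ∀ i, 1 ≤ i → 0 ≤ ω i) (hai : a ≤ i) (haN : a < N) :
    ((∫⁻ w in {w | hitTime X a w < min (passTime X N w) (killTime X w)},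
      discount ω X (hitTime X a w) w ∂P i : ℝ≥0∞) : EReal) = lowerExit Q ω a N (some i) := by
  simp only [min_passTime_killTime]
  exact hX.setLIntegral_discount (S := Finset.Ioo a N)
    (fun x hx => hω x (by have := Finset.mem_Ioo.1 hx; omega))
    (by simpa using haN)
    (fun l hl => by rw [lowerExit_of_notMem, lowerExit_of_notMem] <;> simp [hl])
    (fun x hx => generator_lowerExit hQ ω hx)
    (by rintro _ rfl; exact lowerExit_some_left hQ hω haN)
    (fun o ho => lowerExit_of_notMem Q ω a ho) (hX.ae_exitTime_Ioo_ne_top hQ i a N)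
    (hX.ae_entryTime_eq_exitTime_Ioo hQ hai haN.le)

lemma IsKilledChain.lintegral_occupation_Ioo (hX : IsKilledChain Q X P)
    (hQ : IsRateMatrix Q) (hω : ∀ i, 1 ≤ i → 0 ≤ ω i) {j : ℕ} (hai : a ≤ i) (haN : a < N)
    (hjN : j ≤ N) :
    ((∫⁻ w, timeIntegral (min (hitTime X a w) (min (passTime X N w) (killTime X w)))
      (fun t => {t : ℝ≥0 | X t w = some j}.indicator
        (fun t => discount ω X (t : ℝ≥0∞) w) t) ∂P i : ℝ≥0∞) : EReal) =
      green Q ω a N j (some i) := by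
  simp only [min_passTime_killTime, hitTime, ← entryTime_union]
  refine hX.lintegral_timeIntegral_discount (S := Finset.Ioo a N)
    (fun x hx => hω x (by have := Finset.mem_Ioo.1 hx; omega))
    (fun l hl => by rw [green_of_notMem Q ω a hjN, green_of_notMem Q ω a hjN] <;> simp [hl])
    (fun x hx => generator_green hQ ω hx hjN) ?_ (hX.ae_exitTime_Ioo_ne_top hQ i a N)
    (hX.ae_entryTime_eq_exitTime_Ioo hQ hai haN.le)
  rintro o (rfl | ho)
  · exact green_some_left hQ hω haN j
  · exact green_of_notMem Q ω a hjN ho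

lemma IsKilledChain.setLIntegral_discount_lt_hitTime (hX : IsKilledChain Q X P)
    (hQ : IsRateMatrix Q) (hω : ∀ i, 1 ≤ i → 0 ≤ ω i) (hai : a ≤ i) (haN : a < N) :
    ((∫⁻ w in {w | min (passTime X N w) (killTime X w) < hitTime X a w},
      discount ω X (min (passTime X N w) (killTime X w)) w ∂P i : ℝ≥0∞) : EReal) =
      upperExit Q ω a N (some i) := by
  simp only [min_passTime_killTime]
  exact hX.setLIntegral_discount (S := Finset.Ioo a N)
    (fun x hx => hω x (by have := Finset.mem_Ioo.1 hx; omega))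
    (by simpa using haN)
    (fun l hl => by rw [upperExit_of_notMem, upperExit_of_notMem] <;> simp [hl])
    (fun x hx => generator_upperExit hQ ω hx)
    (fun o ho => upperExit_of_notMem Q ω a ho)
    (by rintro _ rfl; exact upperExit_some_left hQ hω haN) (hX.ae_exitTime_Ioo_ne_top hQ i a N)
    (by simpa only [Set.union_comm] using hX.ae_entryTime_eq_exitTime_Ioo hQ hai haN.le)

end IntervalExit

end SingleDeath

end

theorem mainTheorem5_general {Ω : Type*} [MeasurableSpace Ω]
    (Q : ℕ → ℕ → ℝ) (hQ : IsRateMatrix Q)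
    (c : ℕ → ℝ) (hc : c = killingRate Q)
    (X : ℝ≥0 → Ω → Option ℕ) (P : ℕ → Measure Ω) (hX : IsKilledChain Q X P)
    (ω : ℕ → ℝ) (hω : ∀ i, 1 ≤ i → 0 ≤ ω i) :
    (∀ a i N : ℕ, a < i → i < N →
      ((∫⁻ w in {w | hitTime X a w < min (passTime X N w) (killTime X w)},
          discount ω X (hitTime X a w) w ∂(P i) : ℝ≥0∞) : EReal) =
        ((W Q (ω + c) i N / W Q (ω + c) a N : ℝ) : EReal)) ∧
    (∀ a i j N : ℕ, a < i → a < j → i < N → j < N →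
      ((∫⁻ w, timeIntegral (min (hitTime X a w) (min (passTime X N w) (killTime X w)))
          (fun t => {t : ℝ≥0 | X t w = some j}.indicator
            (fun t => discount ω X (t : ℝ≥0∞) w) t) ∂(P i) : ℝ≥0∞) : EReal) =
        ((W Q (ω + c) a j * W Q (ω + c) i N / W Q (ω + c) a N - W Q (ω + c) i j : ℝ) : EReal)) ∧
    (∀ a i N : ℕ, a < i → i < N →
      ((∫⁻ w in {w | min (passTime X N w) (killTime X w) < hitTime X a w},
          discount ω X (min (passTime X N w) (killTime X w)) w ∂(P i) : ℝ≥0∞) : EReal) =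
        ((1 + ∑ j ∈ Finset.Ioo i N, ω j * W Q (ω + c) i j
          - W Q (ω + c) i N / W Q (ω + c) a N *
            (1 + ∑ j ∈ Finset.Ioo a N, ω j * W Q (ω + c) a j) : ℝ) : EReal)) := by
  subst hc
  refine ⟨fun a i N hai hiN => ?_, fun a i j N hai _ hiN hjN => ?_, fun a i N hai hiN => ?_⟩
  · rw [hX.setLIntegral_discount_hitTime_lt hQ hω hai.le (hai.trans hiN), lowerExit_some]
  · rw [hX.lintegral_occupation_Ioo hQ hω hai.le (hai.trans hiN) hjN.le, green_some]
  · rw [hX.setLIntegral_discount_lt_hitTime hQ hω hai.le (hai.trans hiN),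
      upperExit_some Q ω N hai.le]

theorem mainTheorem5 {Ω : Type*} [MeasurableSpace Ω]
    (Q : ℕ → ℕ → ℝ) (hQ : IsRateMatrix Q)
    (c : ℕ → ℝ) (hc : c = killingRate Q) (hc_pos : ∃ i₀, 1 ≤ i₀ ∧ 0 < c i₀)
    (X : ℝ≥0 → Ω → Option ℕ) (P : ℕ → Measure Ω) (hX : IsKilledChain Q X P)
    (ω : ℕ → ℝ) (hω : ∀ i, 1 ≤ i → 0 ≤ ω i) :
    (∀ a i N : ℕ, a < i → i < N →
      ((∫⁻ w in {w | hitTime X a w < min (passTime X N w) (killTime X w)},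
          discount ω X (hitTime X a w) w ∂(P i) : ℝ≥0∞) : EReal) =
        ((W Q (ω + c) i N / W Q (ω + c) a N : ℝ) : EReal)) ∧
    (∀ a i j N : ℕ, a < i → a < j → i < N → j < N →
      ((∫⁻ w, timeIntegral (min (hitTime X a w) (min (passTime X N w) (killTime X w)))
          (fun t => {t : ℝ≥0 | X t w = some j}.indicator
            (fun t => discount ω X (t : ℝ≥0∞) w) t) ∂(P i) : ℝ≥0∞) : EReal) =
        ((W Q (ω + c) a j * W Q (ω + c) i N / W Q (ω + c) a N - W Q (ω + c) i j : ℝ) : EReal)) ∧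
    (∀ a i N : ℕ, a < i → i < N →
      ((∫⁻ w in {w | min (passTime X N w) (killTime X w) < hitTime X a w},
          discount ω X (min (passTime X N w) (killTime X w)) w ∂(P i) : ℝ≥0∞) : EReal) =
        ((1 + ∑ j ∈ Finset.Ioo i N, ω j * W Q (ω + c) i j
          - W Q (ω + c) i N / W Q (ω + c) a N *
            (1 + ∑ j ∈ Finset.Ioo a N, ω j * W Q (ω + c) a j) : ℝ) : EReal)) :=
  mainTheorem5_general Q hQ c hc X P hX ω hω
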